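/- Let $V\subseteq\mathbb R^n$ be a connected open set with coordinates $U^1,\dots,U^n$, let $G^\alpha_{\beta\gamma},Q^\alpha:V\to\mathbb R$ be smooth functions ($\alpha,\beta,\gamma=1,\dots,n$), and consider the chiral-type system in two independent variables $x,y$ $$\Delta^\alpha\equiv U^\alpha_{xy}+G^\alpha_{\beta\gamma}(U)\,U^\beta_xU^\gamma_y+Q^\alpha(U)=0$$ (summation over repeated indices). A differential function over an open set $W\subseteq V$ is a smooth function of $x,y$, of $U\in W$ and of finitely many partial derivatives of $U$; $D_x,D_y$ are the total derivatives. A tuple $(R_\alpha)$ of differential functions over $W$ is the characteristic of a conservation law over $W$ if there are differential functions $L_1,L_2$ over $W$ with $D_xL_1+D_yL_2=R_\alpha\Delta^\alpha$ identically in $x,y,U\in W$ and the derivatives of $U$. Regard $G^\alpha_{\beta\gamma}$ as the coefficients of an affine connection on $V$ (not necessarily symmetric), with $\nabla_\alpha R_\beta=\partial R_\beta/\partial U^\alpha-G^\delta_{\beta\alpha}R_\delta$. Theorem 2. Let $R_\alpha=R_\alpha(U^1,\dots,U^n)$ be smooth functions on $V$. Then $(R_\alpha)$ is locally the characteristic of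 a conservation law of the system (that is, each point of $V$ has an open neighbourhood $W\subseteq V$ over which it is one) if and only if, on $V$, 1. $R$ is a Killing covector field: $\nabla_{(\alpha}R_{\beta)}=\tfrac12(\nabla_\alpha R_\beta+\nabla_\beta R_\alpha)=0$ for all $\alpha,\beta$; 2. $R_\alpha Q^\alpha$ is constant; 3. the 2-form $\nabla_\alpha R_\beta\,dU^\alpha\wedge dU^\beta$ is closed. If moreover $V$ is star-shaped with respect to one of its points (for example $V=\mathbb R^n$), then 1–3 hold if and only if $(R_\alpha)$ is the characteristic of a conservation law over the whole of $V$. -/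

import Mathlib

open scoped ContDiff

noncomputable section

namespace ChiralType

/-- The infinite jet space of maps `(x, y) ↦ U = (U¹, …, Uⁿ)`. A jet `j` consists of the point
`j.1 = (x, y)` and of the coordinates `j.2 (a, b) α`, standing for `∂ₓᵃ ∂_yᵇ U^α`;
in particular `j.2 (0, 0) = U`. -/
abbrev Jet (n : ℕ) : Type := (ℝ × ℝ) × (ℕ × ℕ → Fin n → ℝ)

/-- The multi-indices `J = (a, b)` of order `a + b ≤ k`. -/
def multiIndices (k : ℕ) : Finset (ℕ × ℕ) :=
  (Finset.range (k + 1) ×ˢ Finset.range (k + 1)).filter fun J => J.1 + J.2 ≤ k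

theorem zero_mem_multiIndices (k : ℕ) : ((0, 0) : ℕ × ℕ) ∈ multiIndices k := by
  simp [multiIndices]

/-- The jet space of order `k`. -/
abbrev FinJet (n k : ℕ) : Type := (ℝ × ℝ) × ({J // J ∈ multiIndices k} → Fin n → ℝ)

/-- The truncation of a jet to order `k`. -/
def truncate {n : ℕ} (k : ℕ) (j : Jet n) : FinJet n k := (j.1, fun J => j.2 J.1)

/-- `P` is a differential function over the domain `V` of the dependent variables: a smooth
function of `x, y, U` and of finitely many derivatives of `U`, where `U` ranges over `V` and
the other jet coordinates are unrestricted. -/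
def IsDifferentialFunction {n : ℕ} (V : Set (Fin n → ℝ)) (P : Jet n → ℝ) : Prop :=
  ∃ (k : ℕ) (p : FinJet n k → ℝ),
    ContDiffOn ℝ ∞ p {j | j.2 ⟨(0, 0), zero_mem_multiIndices k⟩ ∈ V} ∧
    ∀ j : Jet n, j.2 (0, 0) ∈ V → P j = p (truncate k j)

/-- `∂P/∂x` (explicit dependence on `x`). -/
def partialX {n : ℕ} (P : Jet n → ℝ) (j : Jet n) : ℝ :=
  deriv (fun t : ℝ => P ((t, j.1.2), j.2)) j.1.1

/-- `∂P/∂y` (explicit dependence on `y`). -/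
def partialY {n : ℕ} (P : Jet n → ℝ) (j : Jet n) : ℝ :=
  deriv (fun t : ℝ => P ((j.1.1, t), j.2)) j.1.2

/-- `∂P/∂U^α_J`. -/
def partialU {n : ℕ} (J : ℕ × ℕ) (α : Fin n) (P : Jet n → ℝ) (j : Jet n) : ℝ :=
  deriv (fun t : ℝ => P (j.1, Function.update j.2 J (Function.update (j.2 J) α t))) (j.2 J α)

/-- The total derivative `D_x P = ∂P/∂x + ∑_{J, α} U^α_{J,x} ∂P/∂U^α_J`. For a differential
function only finitely many terms of the sum are nonzero. -/
def totalDx {n : ℕ} (P : Jet n → ℝ) (j : Jet n) : ℝ :=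
  partialX P j + ∑ᶠ J : ℕ × ℕ, ∑ α : Fin n, j.2 (J.1 + 1, J.2) α * partialU J α P j

/-- The total derivative `D_y P = ∂P/∂y + ∑_{J, α} U^α_{J,y} ∂P/∂U^α_J`. -/
def totalDy {n : ℕ} (P : Jet n → ℝ) (j : Jet n) : ℝ :=
  partialY P j + ∑ᶠ J : ℕ × ℕ, ∑ α : Fin n, j.2 (J.1, J.2 + 1) α * partialU J α P j

/-- The left-hand side `Δ^α = U^α_{xy} + G^α_{βγ}(U) U^β_x U^γ_y + Q^α(U)` of the
chiral-type system; `G α β γ` is `G^α_{βγ}`. -/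
def systemLHS {n : ℕ} (G : Fin n → Fin n → Fin n → (Fin n → ℝ) → ℝ)
    (Q : Fin n → (Fin n → ℝ) → ℝ) (α : Fin n) (j : Jet n) : ℝ :=
  j.2 (1, 1) α
    + ∑ β : Fin n, ∑ γ : Fin n, G α β γ (j.2 (0, 0)) * j.2 (1, 0) β * j.2 (0, 1) γ
    + Q α (j.2 (0, 0))

/-- The differential functions `R` are the characteristic of a conservation law `(L₁, L₂)` of
the system over the domain `V`: `D_x L₁ + D_y L₂ = R_α Δ^α` identically on jets. -/
def IsCharacteristic {n : ℕ} (V : Set (Fin n → ℝ))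
    (G : Fin n → Fin n → Fin n → (Fin n → ℝ) → ℝ) (Q : Fin n → (Fin n → ℝ) → ℝ)
    (R : Fin n → Jet n → ℝ) : Prop :=
  (∀ α, IsDifferentialFunction V (R α)) ∧
  ∃ L₁ L₂ : Jet n → ℝ,
    IsDifferentialFunction V L₁ ∧ IsDifferentialFunction V L₂ ∧
    ∀ j : Jet n, j.2 (0, 0) ∈ V →
      totalDx L₁ j + totalDy L₂ j = ∑ α : Fin n, R α j * systemLHS G Q α j

/-- The same, locally: near every point of `V` there is such a conservation law. -/
def IsLocalCharacteristic {n : ℕ} (V : Set (Fin n → ℝ))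
    (G : Fin n → Fin n → Fin n → (Fin n → ℝ) → ℝ) (Q : Fin n → (Fin n → ℝ) → ℝ)
    (R : Fin n → Jet n → ℝ) : Prop :=
  ∀ u ∈ V, ∃ W : Set (Fin n → ℝ), IsOpen W ∧ u ∈ W ∧ W ⊆ V ∧ IsCharacteristic W G Q R

/-- Functions `R_α(U)` of the dependent variables alone, as functions on jets. -/
def zerothOrder {n : ℕ} (R : Fin n → (Fin n → ℝ) → ℝ) (α : Fin n) (j : Jet n) : ℝ :=
  R α (j.2 (0, 0))

/-- `∇_α R_β = ∂R_β/∂U^α - G^δ_{βα} R_δ`, the covariant derivative of the covector field `R`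
for the affine connection with coefficients `G^δ_{βγ}`, in general not symmetric in `β, γ`. -/
def covDeriv {n : ℕ} (G : Fin n → Fin n → Fin n → (Fin n → ℝ) → ℝ)
    (R : Fin n → (Fin n → ℝ) → ℝ) (α β : Fin n) (u : Fin n → ℝ) : ℝ :=
  fderiv ℝ (R β) u (Pi.single α 1) - ∑ δ : Fin n, G δ β α u * R δ u

/-- `∇_{(α} R_{β)} = 0` on `V`. -/
def IsKillingCovector {n : ℕ} (V : Set (Fin n → ℝ))
    (G : Fin n → Fin n → Fin n → (Fin n → ℝ) → ℝ) (R : Fin n → (Fin n → ℝ) → ℝ) : Prop :=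
  ∀ u ∈ V, ∀ α β : Fin n, (1 / 2 : ℝ) * (covDeriv G R α β u + covDeriv G R β α u) = 0

/-- The 2-form `dU^α ∧ dU^β`. -/
def dWedge {n : ℕ} (α β : Fin n) : (Fin n → ℝ) [⋀^Fin 2]→L[ℝ] ℝ :=
  ContinuousMultilinearMap.alternatization
    ((ContinuousMultilinearMap.mkPiAlgebra ℝ (Fin 2) ℝ).compContinuousLinearMap
      ![ContinuousLinearMap.proj α, ContinuousLinearMap.proj β])

theorem dWedge_apply {n : ℕ} (α β : Fin n) (v : Fin 2 → Fin n → ℝ) :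
    dWedge α β v = v 0 α * v 1 β - v 0 β * v 1 α := by
  have h := Matrix.det_fin_two (Matrix.of fun a b : Fin 2 => v a (![α, β] b))
  rw [Matrix.det_apply] at h
  simpa [dWedge, ContinuousMultilinearMap.alternatization_apply_apply, Fin.prod_univ_two] using h

/-- The 2-form `∇_α R_β dU^α ∧ dU^β`. -/
def covDerivForm {n : ℕ} (G : Fin n → Fin n → Fin n → (Fin n → ℝ) → ℝ)
    (R : Fin n → (Fin n → ℝ) → ℝ) (u : Fin n → ℝ) : (Fin n → ℝ) [⋀^Fin 2]→L[ℝ] ℝ :=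
  ∑ α : Fin n, ∑ β : Fin n, covDeriv G R α β u • dWedge α β

/-- The three conditions: `R` is a Killing covector field, `R_α Q^α` is constant, and the form
`∇_α R_β dU^α ∧ dU^β` is closed, all on `V`. -/
def SatisfiesConditions {n : ℕ} (V : Set (Fin n → ℝ))
    (G : Fin n → Fin n → Fin n → (Fin n → ℝ) → ℝ) (Q : Fin n → (Fin n → ℝ) → ℝ)
    (R : Fin n → (Fin n → ℝ) → ℝ) : Prop :=
  IsKillingCovector V G R ∧
  (∃ c : ℝ, ∀ u ∈ V, ∑ α : Fin n, R α u * Q α u = c) ∧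
  ∀ u ∈ V, extDeriv (covDerivForm G R) u = 0

end ChiralType

end

/-!
Integrating `R_α U^α_{xy}` by parts in `y` gives
`R_α Δ^α = D_y (R_α U^α_x) + h(U)(U_x, U_y) + q(U)`, with the bilinear form
`h(a, b) = -∇_γ R_β a^β b^γ`, of which `∇_α R_β dU^α ∧ dU^β` is the antisymmetrisation, and
`q = R_α Q^α` (`sum_mul_systemLHS`). So `R` is a characteristic exactly when the Lagrangian
`h(U)(U_x, U_y) + q(U)` is a total divergence.

*Necessity.* Along a map `u` of the plane, total derivatives become ordinary partial derivatives
(`totalDx_eq`, `fderiv_comp_variationJet`). For a variation `u + ε χ e` with a test function `χ`,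
the derivative in `ε` of a divergence integrates to zero
(`integral_firstVariation_eq_zero`), so after an integration by parts the Euler-Lagrange expression
of the Lagrangian vanishes along every `u` (`eulerLagrange_eq_zero`). At a point it is a polynomial
in `U_x, U_y, U_xy`: its parts of degree zero, of degree one in `U_xy` and of degree one in each of
`U_x, U_y` say that `dq = 0`, that `h` is antisymmetric and that `dh = 0`
(`conditions_of_eulerLagrange`). On the connected set `V`, `dq = 0` means that `q` is constant. This
route needs no calculus of the Euler operator on jets.

*Sufficiency.* If `q = c` and `h` is antisymmetric and closed, the Poincaré lemma
(`exists_primitive`) gives a 1-form `θ` with `dθ = h` on a star-shaped domain, and then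
`h(U)(U_x, U_y) = D_x (θ_α U^α_y) - D_y (θ_α U^α_x)`, so that `L₁ = θ_α U^α_y + c x` and
`L₂ = (R_α - θ_α) U^α_x` form a conservation law (`isCharacteristic_of_satisfiesConditions`).
Balls are star-shaped, which gives the local statement.
-/

noncomputable section

open Set Filter Topology MeasureTheory

namespace ChiralType

/-! ### Total derivatives of differential functions -/

section Jets

variable {n k : ℕ} {W : Set (Fin n → ℝ)} {P : Jet n → ℝ} {p : FinJet n k → ℝ}

/-- The domain of the functions that represent differential functions over `W`. -/
def jetDomain (k : ℕ) (W : Set (Fin n → ℝ)) : Set (FinJet n k) :=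
  {j | j.2 ⟨(0, 0), zero_mem_multiIndices k⟩ ∈ W}

theorem isOpen_jetDomain (hW : IsOpen W) : IsOpen (jetDomain k W) :=
  hW.preimage (by fun_prop)

theorem hasFDerivAt_jet (hW : IsOpen W) (hp : ContDiffOn ℝ ∞ p (jetDomain k W))
    {w : FinJet n k} (hw : w ∈ jetDomain k W) : HasFDerivAt p (fderiv ℝ p w) w :=
  ((hp.contDiffAt ((isOpen_jetDomain hW).mem_nhds hw)).differentiableAt (by simp)).hasFDerivAt

theorem partialX_eq (hW : IsOpen W) (hp : ContDiffOn ℝ ∞ p (jetDomain k W))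
    (hP : ∀ j : Jet n, j.2 (0, 0) ∈ W → P j = p (truncate k j)) (j : Jet n)
    (hj : j.2 (0, 0) ∈ W) : partialX P j = fderiv ℝ p (truncate k j) ((1, 0), 0) := by
  have h1 : HasDerivAt (fun t : ℝ => (((t, j.1.2), fun J => j.2 J.1) : FinJet n k))
      ((1, 0), 0) j.1.1 :=
    ((hasDerivAt_id _).prodMk (hasDerivAt_const _ _)).prodMk (hasDerivAt_const _ _)
  have h2 := HasFDerivAt.comp_hasDerivAt (x := j.1.1) (hf := h1)
    (hl := hasFDerivAt_jet hW hp (w := truncate k j) hj)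
  rw [partialX, ← h2.deriv]
  congr 1
  funext t
  exact hP ((t, j.1.2), j.2) hj

theorem partialY_eq (hW : IsOpen W) (hp : ContDiffOn ℝ ∞ p (jetDomain k W))
    (hP : ∀ j : Jet n, j.2 (0, 0) ∈ W → P j = p (truncate k j)) (j : Jet n)
    (hj : j.2 (0, 0) ∈ W) : partialY P j = fderiv ℝ p (truncate k j) ((0, 1), 0) := by
  have h1 : HasDerivAt (fun t : ℝ => (((j.1.1, t), fun J => j.2 J.1) : FinJet n k))
      ((0, 1), 0) j.1.2 :=
    ((hasDerivAt_const _ _).prodMk (hasDerivAt_id _)).prodMk (hasDerivAt_const _ _)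
  have h2 := HasFDerivAt.comp_hasDerivAt (x := j.1.2) (hf := h1)
    (hl := hasFDerivAt_jet hW hp (w := truncate k j) hj)
  rw [partialY, ← h2.deriv]
  congr 1
  funext t
  exact hP ((j.1.1, t), j.2) hj

theorem partialU_eq (hW : IsOpen W) (hp : ContDiffOn ℝ ∞ p (jetDomain k W))
    (hP : ∀ j : Jet n, j.2 (0, 0) ∈ W → P j = p (truncate k j)) (j : Jet n)
    (hj : j.2 (0, 0) ∈ W) (J : {J // J ∈ multiIndices k}) (α : Fin n) :
    partialU J.1 α P j = fderiv ℝ p (truncate k j) (0, Pi.single J (Pi.single α 1)) := by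
  have h1 : HasDerivAt (fun t : ℝ => truncate k
      (j.1, Function.update j.2 J.1 (Function.update (j.2 J.1) α t)))
      (0, Pi.single J (Pi.single α 1)) (j.2 J.1 α) := by
    refine (hasDerivAt_const _ _).prodMk (hasDerivAt_pi.2 fun I => ?_)
    by_cases hI : I = J
    · subst hI
      simpa using hasDerivAt_update (j.2 I.1) α (j.2 I.1 α)
    · have : I.1 ≠ J.1 := fun h => hI (Subtype.ext h)
      simpa [this, hI] using hasDerivAt_const _ _
  have h0 : truncate k (j.1, Function.update j.2 J.1 (Function.update (j.2 J.1) α (j.2 J.1 α)))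
      = truncate k j := by simp
  have h2 := HasFDerivAt.comp_hasDerivAt (x := j.2 J.1 α) (hf := h1)
    (hl := hasFDerivAt_jet hW hp (by rw [h0]; exact hj))
  rw [partialU]
  rw [h0] at h2
  rw [← h2.deriv]
  have hc := h1.continuousAt.preimage_mem_nhds
    ((isOpen_jetDomain hW).mem_nhds (by rw [h0]; exact hj))
  refine Filter.EventuallyEq.deriv_eq ?_
  filter_upwards [hc] with t ht
  exact hP _ ht

theorem partialU_eq_zero
    (hP : ∀ j : Jet n, j.2 (0, 0) ∈ W → P j = p (truncate k j)) (j : Jet n)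
    (hj : j.2 (0, 0) ∈ W) {J : ℕ × ℕ} (hJ : J ∉ multiIndices k) (α : Fin n) :
    partialU J α P j = 0 := by
  have hne : ∀ I ∈ multiIndices k, I ≠ J := fun I hI h => hJ (h ▸ hI)
  have : (fun t : ℝ => P (j.1, Function.update j.2 J (Function.update (j.2 J) α t)))
      = fun _ => p (truncate k j) := by
    funext t
    rw [hP]
    · congr 1
      refine Prod.ext rfl (funext fun I => ?_)
      simp [truncate, Function.update_of_ne (hne I.1 I.2)]
    · simpa [Function.update_of_ne (hne _ (zero_mem_multiIndices k))] using hj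
  rw [partialU, this, deriv_const]

/-- The prolonged vector field of a total derivative acts as the differential of the
representing function. -/
theorem finsum_partialU_eq (hW : IsOpen W) (hp : ContDiffOn ℝ ∞ p (jetDomain k W))
    (hP : ∀ j : Jet n, j.2 (0, 0) ∈ W → P j = p (truncate k j)) (j : Jet n)
    (hj : j.2 (0, 0) ∈ W) (w : ℕ × ℕ → Fin n → ℝ) :
    ∑ᶠ J : ℕ × ℕ, ∑ α : Fin n, w J α * partialU J α P j
      = fderiv ℝ p (truncate k j) (0, fun J => w J.1) := by
  rw [finsum_eq_sum_of_support_subset (s := multiIndices k)]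
  · rw [← Finset.sum_coe_sort]
    have : ((0, fun J => w J.1) : FinJet n k)
        = ∑ J : {J // J ∈ multiIndices k}, ∑ α, w J.1 α • (0, Pi.single J (Pi.single α 1)) := by
      refine Prod.ext (by simp [Prod.fst_sum]) ?_
      simp only [Prod.snd_sum, Prod.smul_snd]
      funext I α
      simp [Finset.sum_apply, Pi.single_apply, Finset.sum_ite_eq, ite_apply]
    rw [this, map_sum]
    refine Finset.sum_congr rfl fun J _ => ?_
    rw [map_sum]
    refine Finset.sum_congr rfl fun α _ => ?_
    rw [map_smul, smul_eq_mul, ← partialU_eq hW hp hP j hj]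
  · intro J hJ
    by_contra h
    exact hJ (Finset.sum_eq_zero fun α _ => by
      rw [partialU_eq_zero hP j hj (by simpa using h), mul_zero])

theorem totalDx_eq (hW : IsOpen W) (hp : ContDiffOn ℝ ∞ p (jetDomain k W))
    (hP : ∀ j : Jet n, j.2 (0, 0) ∈ W → P j = p (truncate k j)) (j : Jet n)
    (hj : j.2 (0, 0) ∈ W) : totalDx P j
      = fderiv ℝ p (truncate k j) ((1, 0), fun J => j.2 (J.1.1 + 1, J.1.2)) := by
  rw [totalDx, partialX_eq hW hp hP j hj,
    finsum_partialU_eq hW hp hP j hj fun J => j.2 (J.1 + 1, J.2), ← map_add]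
  simp

theorem totalDy_eq (hW : IsOpen W) (hp : ContDiffOn ℝ ∞ p (jetDomain k W))
    (hP : ∀ j : Jet n, j.2 (0, 0) ∈ W → P j = p (truncate k j)) (j : Jet n)
    (hj : j.2 (0, 0) ∈ W) : totalDy P j
      = fderiv ℝ p (truncate k j) ((0, 1), fun J => j.2 (J.1.1, J.1.2 + 1)) := by
  rw [totalDy, partialY_eq hW hp hP j hj,
    finsum_partialU_eq hW hp hP j hj fun J => j.2 (J.1, J.2 + 1), ← map_add]
  simp

end Jets

/-! ### Prolongation of maps of the plane -/

section Prolongation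

variable {E : Type*} [NormedAddCommGroup E] [NormedSpace ℝ E]

/-- The partial derivative in `x` of a map of the plane. -/
def dX (f : ℝ × ℝ → E) (z : ℝ × ℝ) : E := fderiv ℝ f z (1, 0)

/-- The partial derivative in `y` of a map of the plane. -/
def dY (f : ℝ × ℝ → E) (z : ℝ × ℝ) : E := fderiv ℝ f z (0, 1)

/-- The prolongation of a map of the plane: the family of its partial derivatives. -/
def prolong (f : ℝ × ℝ → E) (z : ℝ × ℝ) (J : ℕ × ℕ) : E := dX^[J.1] (dY^[J.2] f) z

theorem contDiff_dX {f : ℝ × ℝ → E} (hf : ContDiff ℝ ∞ f) : ContDiff ℝ ∞ (dX f) :=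
  (hf.fderiv_right (m := ∞) (by simp)).clm_apply contDiff_const

theorem contDiff_dY {f : ℝ × ℝ → E} (hf : ContDiff ℝ ∞ f) : ContDiff ℝ ∞ (dY f) :=
  (hf.fderiv_right (m := ∞) (by simp)).clm_apply contDiff_const

theorem contDiff_iterate_dX {f : ℝ × ℝ → E} (hf : ContDiff ℝ ∞ f) (a : ℕ) :
    ContDiff ℝ ∞ (dX^[a] f) := by
  induction a with
  | zero => exact hf
  | succ a ih => rw [Function.iterate_succ_apply']; exact contDiff_dX ih

theorem contDiff_iterate_dY {f : ℝ × ℝ → E} (hf : ContDiff ℝ ∞ f) (a : ℕ) :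
    ContDiff ℝ ∞ (dY^[a] f) := by
  induction a with
  | zero => exact hf
  | succ a ih => rw [Function.iterate_succ_apply']; exact contDiff_dY ih

/-- Smoothness makes second derivatives symmetric; stated for a function that is smooth near a
single point because the potentials of a conservation law are defined over `W` only. -/
theorem fderiv_fderiv_comm {X : Type*} [NormedAddCommGroup X] [NormedSpace ℝ X] {f : X → E}
    {x : X} (hf : ContDiffAt ℝ ∞ f x) (a b : X) :
    fderiv ℝ (fun y => fderiv ℝ f y a) x b = fderiv ℝ (fun y => fderiv ℝ f y b) x a := by
  have hd : DifferentiableAt ℝ (fderiv ℝ f) x :=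
    (hf.fderiv_right (m := ∞) (by simp)).differentiableAt (by simp)
  have hs := hf.isSymmSndFDerivAt (by
    rw [minSmoothness_of_isRCLikeNormedField]
    exact WithTop.coe_le_coe.2 (le_top : (2 : ℕ∞) ≤ ⊤))
  rw [fderiv_clm_apply hd (differentiableAt_const _),
    fderiv_clm_apply hd (differentiableAt_const _)]
  simpa using hs b a

theorem dY_iterate_dX {f : ℝ × ℝ → E} (hf : ContDiff ℝ ∞ f) (a : ℕ) :
    dY (dX^[a] f) = dX^[a] (dY f) := by
  induction a with
  | zero => rfl
  | succ a ih =>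
    rw [Function.iterate_succ_apply', Function.iterate_succ_apply', ← ih]
    funext z
    exact fderiv_fderiv_comm (contDiff_iterate_dX hf a).contDiffAt _ _

theorem contDiff_prolong {f : ℝ × ℝ → E} (hf : ContDiff ℝ ∞ f) (J : ℕ × ℕ) :
    ContDiff ℝ ∞ fun z => prolong f z J :=
  contDiff_iterate_dX (contDiff_iterate_dY hf _) _

theorem dX_prolong (f : ℝ × ℝ → E) (J : ℕ × ℕ) :
    dX (fun z => prolong f z J) = fun z => prolong f z (J.1 + 1, J.2) := by
  funext z
  rw [prolong, Function.iterate_succ_apply']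
  rfl

theorem dY_prolong {f : ℝ × ℝ → E} (hf : ContDiff ℝ ∞ f) (J : ℕ × ℕ) :
    dY (fun z => prolong f z J) = fun z => prolong f z (J.1, J.2 + 1) := by
  funext z
  rw [prolong, Function.iterate_succ_apply', ← dY_iterate_dX (contDiff_iterate_dY hf _)]
  rfl

/-- A map that vanishes off a closed set has all its partial derivatives zero there. -/
theorem prolong_eq_zero {f : ℝ × ℝ → E} {K : Set (ℝ × ℝ)} (hK : IsClosed K)
    (hf : ∀ z ∉ K, f z = 0) (J : ℕ × ℕ) : ∀ z ∉ K, prolong f z J = 0 := by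
  have key : ∀ (g : ℝ × ℝ → E) (v : ℝ × ℝ), (∀ z ∉ K, g z = 0) →
      ∀ z ∉ K, fderiv ℝ g z v = 0 := by
    intro g v hg z hz
    have : g =ᶠ[𝓝 z] fun _ => 0 := by
      filter_upwards [hK.isOpen_compl.mem_nhds hz] with y hy using hg y hy
    rw [this.fderiv_eq]
    simp
  have hy : ∀ b, ∀ z ∉ K, dY^[b] f z = 0 := by
    intro b
    induction b with
    | zero => exact hf
    | succ b ih => rw [Function.iterate_succ_apply']; exact key _ _ ih
  have hx : ∀ a, ∀ z ∉ K, dX^[a] (dY^[J.2] f) z = 0 := by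
    intro a
    induction a with
    | zero => exact hy _
    | succ b ih => rw [Function.iterate_succ_apply']; exact key _ _ ih
  exact hx _

end Prolongation

/-! ### Divergences integrate to zero -/

theorem integral_fderiv_apply_eq_zero {f : ℝ × ℝ → ℝ} (hf : ContDiff ℝ ∞ f)
    (hc : HasCompactSupport f) (v : ℝ × ℝ) : ∫ z, fderiv ℝ f z v = 0 := by
  have hd : Continuous fun z => fderiv ℝ f z v :=
    ((hf.fderiv_right (m := ∞) (by simp)).clm_apply contDiff_const).continuous
  have h := integral_mul_fderiv_eq_neg_fderiv_mul_of_integrable (μ := volume)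
    (f := fun _ : ℝ × ℝ => (1 : ℝ)) (g := f) (v := v) (by simp)
    (by simpa using hd.integrable_of_hasCompactSupport (hc.fderiv_apply (𝕜 := ℝ) v))
    (by simpa using hf.continuous.integrable_of_hasCompactSupport hc)
    (fun _ _ => differentiableAt_const _) (fun z _ => hf.differentiable (by simp) z)
  simpa using h

theorem integrable_mul_of_tsupport_subset {O : Set (ℝ × ℝ)} (hO : IsOpen O) {χ f : ℝ × ℝ → ℝ}
    (hχ : Continuous χ) (hc : HasCompactSupport χ) (hs : tsupport χ ⊆ O)
    (hf : ContinuousOn f O) : Integrable fun z => χ z * f z := by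
  refine Continuous.integrable_of_hasCompactSupport ?_ hc.mul_right
  refine continuous_iff_continuousAt.2 fun z => ?_
  by_cases hz : z ∈ tsupport χ
  · exact hχ.continuousAt.mul (hf.continuousAt (hO.mem_nhds (hs hz)))
  · have : (fun z => χ z * f z) =ᶠ[𝓝 z] fun _ => 0 := by
      filter_upwards [(isClosed_tsupport χ).isOpen_compl.mem_nhds hz] with y hy
      rw [image_eq_zero_of_notMem_tsupport hy, zero_mul]
    exact continuousAt_const.congr this.symm

/-- Integration by parts against a test function supported where `f` is smooth. -/
theorem integral_fderiv_mul_eq_neg {O : Set (ℝ × ℝ)} (hO : IsOpen O) {χ f : ℝ × ℝ → ℝ}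
    (hχ : ContDiff ℝ ∞ χ) (hc : HasCompactSupport χ) (hs : tsupport χ ⊆ O)
    (hf : ContDiffOn ℝ ∞ f O) (v : ℝ × ℝ) :
    ∫ z, fderiv ℝ χ z v * f z = - ∫ z, χ z * fderiv ℝ f z v := by
  have h := integral_mul_fderiv_eq_neg_fderiv_mul_of_integrable (μ := volume)
    (f := f) (g := χ) (v := v) ?_ ?_ ?_
    (fun z hz => ((hf.contDiffAt (hO.mem_nhds (hs hz))).differentiableAt (by simp)))
    (fun z _ => hχ.differentiable (by simp) z)
  · simpa only [mul_comm] using h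
  · simp only [mul_comm _ (χ _)]
    exact integrable_mul_of_tsupport_subset hO hχ.continuous hc hs
      ((hf.fderiv_of_isOpen (m := ∞) hO (by simp)).clm_apply contDiffOn_const).continuousOn
  · simp only [mul_comm (f _)]
    exact integrable_mul_of_tsupport_subset hO
      ((hχ.fderiv_right (m := ∞) (by simp)).clm_apply contDiff_const).continuous
      (hc.fderiv_apply (𝕜 := ℝ) v) ((tsupport_fderiv_apply_subset ℝ v).trans hs) hf.continuousOn
  · simp only [mul_comm (f _)]
    exact integrable_mul_of_tsupport_subset hO hχ.continuous hc hs hf.continuousOn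

/-- The derivative of a function of `(z, ε)` in `ε` at `ε = 0`. -/
def firstVariation (f : (ℝ × ℝ) × ℝ → ℝ) (z : ℝ × ℝ) : ℝ := deriv (fun ε : ℝ => f (z, ε)) 0

theorem firstVariation_eq {f : (ℝ × ℝ) × ℝ → ℝ} {z : ℝ × ℝ} (hf : DifferentiableAt ℝ f (z, 0)) :
    firstVariation f z = fderiv ℝ f (z, 0) (0, 1) := by
  have h1 : HasDerivAt (fun ε : ℝ => (z, ε)) ((0 : ℝ × ℝ), (1 : ℝ)) 0 :=
    (hasDerivAt_const _ _).prodMk (hasDerivAt_id _)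
  exact (HasFDerivAt.comp_hasDerivAt (x := (0 : ℝ)) (hl := hf.hasFDerivAt) (hf := h1)).deriv

theorem firstVariation_eq_zero {f : (ℝ × ℝ) × ℝ → ℝ} {z : ℝ × ℝ}
    (hf : ∀ ε, f (z, ε) = f (z, 0)) : firstVariation f z = 0 := by
  rw [firstVariation, funext hf, deriv_const]

section

variable {O : Set ((ℝ × ℝ) × ℝ)} {f : (ℝ × ℝ) × ℝ → ℝ} {K : Set (ℝ × ℝ)}

/-- The first variation is smooth on the whole plane although `f` is smooth on `O` only: off `K`
`f` does not depend on `ε`, so the first variation vanishes there whatever `f` is. -/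
theorem contDiff_firstVariation (hO : IsOpen O) (hf : ContDiffOn ℝ ∞ f O) (hK : IsClosed K)
    (hKO : ∀ z ∈ K, (z, (0 : ℝ)) ∈ O) (h : ∀ z ∉ K, ∀ ε, f (z, ε) = f (z, 0)) :
    ContDiff ℝ ∞ (firstVariation f) := by
  refine contDiff_iff_contDiffAt.2 fun z => ?_
  by_cases hz : z ∈ K
  · have hι : Continuous fun y : ℝ × ℝ => (y, (0 : ℝ)) := by fun_prop
    have he : firstVariation f =ᶠ[𝓝 z] fun y => fderiv ℝ f (y, 0) (0, 1) := by
      filter_upwards [(hO.preimage hι).mem_nhds (hKO z hz)] with y hy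
      exact firstVariation_eq ((hf.contDiffAt (hO.mem_nhds hy)).differentiableAt (by simp))
    refine ContDiffAt.congr_of_eventuallyEq ?_ he
    have h1 : ContDiffAt ℝ ∞ (fun w => fderiv ℝ f w (0, 1)) (z, 0) :=
      (((hf.contDiffAt (hO.mem_nhds (hKO z hz))).fderiv_right (m := ∞) (by simp))).clm_apply
        contDiffAt_const
    exact h1.comp (f := fun y : ℝ × ℝ => (y, (0 : ℝ))) z
      (contDiffAt_id.prodMk contDiffAt_const)
  · have he : firstVariation f =ᶠ[𝓝 z] fun _ => 0 := by
      filter_upwards [hK.isOpen_compl.mem_nhds hz] with y hy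
      exact firstVariation_eq_zero (h y hy)
    exact contDiffAt_const.congr_of_eventuallyEq he

/-- Partial derivatives commute with the first variation. -/
theorem fderiv_firstVariation (hO : IsOpen O) (hf : ContDiffOn ℝ ∞ f O) {z : ℝ × ℝ}
    (hz : (z, (0 : ℝ)) ∈ O) (v : ℝ × ℝ) :
    fderiv ℝ (firstVariation f) z v = fderiv ℝ (fun w => fderiv ℝ f w (v, 0)) (z, 0) (0, 1) := by
  have hι : Continuous fun y : ℝ × ℝ => (y, (0 : ℝ)) := by fun_prop
  have he : firstVariation f =ᶠ[𝓝 z] fun y => fderiv ℝ f (y, 0) (0, 1) := by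
    filter_upwards [(hO.preimage hι).mem_nhds hz] with y hy
    exact firstVariation_eq ((hf.contDiffAt (hO.mem_nhds hy)).differentiableAt (by simp))
  have hc := hf.contDiffAt (hO.mem_nhds hz)
  have h1 : ContDiffAt ℝ ∞ (fun w => fderiv ℝ f w (0, 1)) (z, 0) :=
    (hc.fderiv_right (m := ∞) (by simp)).clm_apply contDiffAt_const
  have h2 : HasFDerivAt (fun y : ℝ × ℝ => (y, (0 : ℝ)))
      ((ContinuousLinearMap.id ℝ _).prod 0) z :=
    (hasFDerivAt_id z).prodMk (hasFDerivAt_const _ _)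
  rw [he.fderiv_eq, fderiv_fderiv_comm hc]
  have h3 := HasFDerivAt.comp z (g := fun w => fderiv ℝ f w (0, 1))
    (h1.differentiableAt (by simp)).hasFDerivAt h2
  have h4 := congrArg (· v) h3.fderiv
  simpa [Function.comp_def] using h4

/-- The first variation of a divergence integrates to zero when the variation is supported in
the compact set `K`. -/
theorem integral_firstVariation_eq_zero {f₁ f₂ F : (ℝ × ℝ) × ℝ → ℝ} (hO : IsOpen O)
    (hf₁ : ContDiffOn ℝ ∞ f₁ O) (hf₂ : ContDiffOn ℝ ∞ f₂ O)
    (hdiv : ∀ w ∈ O, fderiv ℝ f₁ w ((1, 0), 0) + fderiv ℝ f₂ w ((0, 1), 0) = F w)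
    (hK : IsCompact K) (hKO : ∀ z ∈ K, (z, (0 : ℝ)) ∈ O)
    (h₁ : ∀ z ∉ K, ∀ ε, f₁ (z, ε) = f₁ (z, 0)) (h₂ : ∀ z ∉ K, ∀ ε, f₂ (z, ε) = f₂ (z, 0))
    (hF : ∀ z ∉ K, ∀ ε, F (z, ε) = F (z, 0)) :
    ∫ z, firstVariation F z = 0 := by
  have hc₁ := contDiff_firstVariation hO hf₁ hK.isClosed hKO h₁
  have hc₂ := contDiff_firstVariation hO hf₂ hK.isClosed hKO h₂
  have hs₁ : HasCompactSupport (firstVariation f₁) :=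
    HasCompactSupport.intro hK fun z hz => firstVariation_eq_zero (h₁ z hz)
  have hs₂ : HasCompactSupport (firstVariation f₂) :=
    HasCompactSupport.intro hK fun z hz => firstVariation_eq_zero (h₂ z hz)
  have hi : ∀ {g : ℝ × ℝ → ℝ} (v : ℝ × ℝ), ContDiff ℝ ∞ g → HasCompactSupport g →
      Integrable fun z => fderiv ℝ g z v := fun v hg hs =>
    ((hg.fderiv_right (m := ∞) (by simp)).clm_apply
      contDiff_const).continuous.integrable_of_hasCompactSupport (hs.fderiv_apply (𝕜 := ℝ) v)
  have key : ∀ z, firstVariation F z = fderiv ℝ (firstVariation f₁) z (1, 0)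
      + fderiv ℝ (firstVariation f₂) z (0, 1) := by
    intro z
    by_cases hz : z ∈ K
    · have hzO := hKO z hz
      have hd : ∀ {f : (ℝ × ℝ) × ℝ → ℝ} (v : ℝ × ℝ), ContDiffOn ℝ ∞ f O →
          DifferentiableAt ℝ (fun w => fderiv ℝ f w (v, 0)) (z, 0) := fun v hf =>
        (((hf.contDiffAt (hO.mem_nhds hzO)).fderiv_right (m := ∞) (by simp)).clm_apply
          contDiffAt_const).differentiableAt (by simp)
      have he : F =ᶠ[𝓝 (z, 0)] fun w =>
          fderiv ℝ f₁ w ((1, 0), 0) + fderiv ℝ f₂ w ((0, 1), 0) := by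
        filter_upwards [hO.mem_nhds hzO] with w hw using (hdiv w hw).symm
      rw [firstVariation_eq ((((hd _ hf₁).add (hd _ hf₂))).congr_of_eventuallyEq he), he.fderiv_eq,
        fderiv_firstVariation hO hf₁ hzO, fderiv_firstVariation hO hf₂ hzO,
        fderiv_fun_add (hd _ hf₁) (hd _ hf₂)]
      rfl
    · have h0 : ∀ {f : (ℝ × ℝ) × ℝ → ℝ} (v : ℝ × ℝ), (∀ z ∉ K, ∀ ε, f (z, ε) = f (z, 0)) →
          fderiv ℝ (firstVariation f) z v = 0 := by
        intro f v h
        have he : firstVariation f =ᶠ[𝓝 z] fun _ => 0 := by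
          filter_upwards [hK.isClosed.isOpen_compl.mem_nhds hz] with y hy
          exact firstVariation_eq_zero (h y hy)
        rw [he.fderiv_eq]
        simp
      rw [h0 _ h₁, h0 _ h₂, firstVariation_eq_zero (hF z hz), add_zero]
  simp_rw [key]
  rw [integral_add (hi _ hc₁ hs₁) (hi _ hc₂ hs₂), integral_fderiv_apply_eq_zero hc₁ hs₁,
    integral_fderiv_apply_eq_zero hc₂ hs₂, add_zero]

end

/-! ### The Euler-Lagrange equations -/

-- The norm on `E →L[ℝ] E →L[ℝ] E →L[ℝ] ℝ`, where `fderiv ℝ h` takes its values, is not found at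
-- the default depth.
set_option maxSynthPendingDepth 3

section EulerLagrange

variable {E : Type*} [NormedAddCommGroup E] [NormedSpace ℝ E]

/-- The Lagrangian `h(U)(Uₓ, U_y) + q(U)` along the variation `u + ε φ`. -/
def lagrangian (h : E → E →L[ℝ] E →L[ℝ] ℝ) (q : E → ℝ) (u φ : ℝ × ℝ → E)
    (w : (ℝ × ℝ) × ℝ) : ℝ :=
  h (u w.1 + w.2 • φ w.1) (dX u w.1 + w.2 • dX φ w.1) (dY u w.1 + w.2 • dY φ w.1)
    + q (u w.1 + w.2 • φ w.1)

/-- The Euler-Lagrange expression of `h(U)(Uₓ, U_y) + q(U)`, paired with `e`, at a jet with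
`U = c`, `Uₓ = a`, `U_y = b` and `U_xy = m`. -/
def eulerLagrange (h : E → E →L[ℝ] E →L[ℝ] ℝ) (q : E → ℝ) (c a b m e : E) : ℝ :=
  fderiv ℝ h c e a b + fderiv ℝ q c e - (fderiv ℝ h c a e b + h c e m)
    - (fderiv ℝ h c b a e + h c m e)

/-- If the first variation integrates to zero for all test functions, then the Euler-Lagrange
expression vanishes; `u` realises an arbitrary jet at the origin. -/
theorem eulerLagrange_eq_zero {W : Set E} (hW : IsOpen W) {h : E → E →L[ℝ] E →L[ℝ] ℝ} {q : E → ℝ}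
    (hh : ContDiffOn ℝ ∞ h W) (hq : ContDiffOn ℝ ∞ q W)
    (hvar : ∀ (u : ℝ × ℝ → E) (e : E) (χ : ℝ × ℝ → ℝ), ContDiff ℝ ∞ u → ContDiff ℝ ∞ χ →
      HasCompactSupport χ → tsupport χ ⊆ u ⁻¹' W →
      ∫ z, firstVariation (lagrangian h q u fun z => χ z • e) z = 0)
    {c : E} (hc : c ∈ W) (a b m e : E) : eulerLagrange h q c a b m e = 0 := by
  set u : ℝ × ℝ → E := fun z => c + z.1 • a + z.2 • b + (z.1 * z.2) • m with hu_def
  have hu : ContDiff ℝ ∞ u := by fun_prop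
  have hdu : ∀ z : ℝ × ℝ, HasFDerivAt u
      ((ContinuousLinearMap.fst ℝ ℝ ℝ).smulRight a + (ContinuousLinearMap.snd ℝ ℝ ℝ).smulRight b
        + (z.1 • ContinuousLinearMap.snd ℝ ℝ ℝ + z.2 • ContinuousLinearMap.fst ℝ ℝ ℝ).smulRight m)
      z := fun z =>
    (((hasFDerivAt_fst.smul_const a).const_add c).add (hasFDerivAt_snd.smul_const b)).add
      ((hasFDerivAt_fst.mul hasFDerivAt_snd).smul_const m)
  have hux : dX u = fun z => a + z.2 • m := by
    funext z; simp [dX, (hdu z).fderiv]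
  have huy : dY u = fun z => b + z.1 • m := by
    funext z; simp [dY, (hdu z).fderiv]
  set O : Set (ℝ × ℝ) := u ⁻¹' W
  have hO : IsOpen O := hW.preimage hu.continuous
  have h0 : (0 : ℝ × ℝ) ∈ O := by simpa [O, hu_def] using hc
  have hhu : ContDiffOn ℝ ∞ (fun z => h (u z)) O := hh.comp hu.contDiffOn fun _ hz => hz
  have hdh : ContDiffOn ℝ ∞ (fun z => fderiv ℝ h (u z)) O :=
    (hh.fderiv_of_isOpen (m := ∞) hW (by simp)).comp hu.contDiffOn fun _ hz => hz
  have hdq : ContDiffOn ℝ ∞ (fun z => fderiv ℝ q (u z)) O :=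
    (hq.fderiv_of_isOpen (m := ∞) hW (by simp)).comp hu.contDiffOn fun _ hz => hz
  have cux : ContDiff ℝ ∞ (dX u) := contDiff_dX hu
  have cuy : ContDiff ℝ ∞ (dY u) := contDiff_dY hu
  -- The coefficients of `χ`, `χₓ` and `χ_y` in the first variation along `χ e`.
  set A : ℝ × ℝ → ℝ := fun z => fderiv ℝ h (u z) e (dX u z) (dY u z) + fderiv ℝ q (u z) e
  set B : ℝ × ℝ → ℝ := fun z => h (u z) e (dY u z)
  set C : ℝ × ℝ → ℝ := fun z => h (u z) (dX u z) e
  have hA : ContDiffOn ℝ ∞ A O :=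
    ((((hdh.clm_apply contDiffOn_const).clm_apply cux.contDiffOn).clm_apply
      cuy.contDiffOn)).add (hdq.clm_apply contDiffOn_const)
  have hB : ContDiffOn ℝ ∞ B O := (hhu.clm_apply contDiffOn_const).clm_apply cuy.contDiffOn
  have hC : ContDiffOn ℝ ∞ C O := (hhu.clm_apply cux.contDiffOn).clm_apply contDiffOn_const
  have hBx : ContDiffOn ℝ ∞ (fun z => fderiv ℝ B z (1, 0)) O :=
    (hB.fderiv_of_isOpen (m := ∞) hO (by simp)).clm_apply contDiffOn_const
  have hCy : ContDiffOn ℝ ∞ (fun z => fderiv ℝ C z (0, 1)) O :=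
    (hC.fderiv_of_isOpen (m := ∞) hO (by simp)).clm_apply contDiffOn_const
  have key : ∀ᵐ z ∂(volume : Measure (ℝ × ℝ)),
      z ∈ O → A z - fderiv ℝ B z (1, 0) - fderiv ℝ C z (0, 1) = 0 := by
    refine hO.ae_eq_zero_of_integral_contDiff_smul_eq_zero
      (((hA.sub hBx).sub hCy).continuousOn.locallyIntegrableOn hO.measurableSet) ?_
    intro χ hχ hχc hχs
    have hint := hvar u e χ hu hχ hχc hχs
    have hfv : ∀ z, firstVariation (lagrangian h q u fun z => χ z • e) z
        = χ z * A z + fderiv ℝ χ z (1, 0) * B z + fderiv ℝ χ z (0, 1) * C z := by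
      intro z
      have hφ : HasFDerivAt (fun z => χ z • e) ((fderiv ℝ χ z).smulRight e) z :=
        (hχ.differentiable (by simp) z).hasFDerivAt.smul_const e
      have hφx : dX (fun z => χ z • e) z = fderiv ℝ χ z (1, 0) • e := by simp [dX, hφ.fderiv]
      have hφy : dY (fun z => χ z • e) z = fderiv ℝ χ z (0, 1) • e := by simp [dY, hφ.fderiv]
      simp only [firstVariation, lagrangian, hφx, hφy]
      by_cases hz : z ∈ tsupport χ
      · have hzW : u z + (0 : ℝ) • χ z • e ∈ W := by
          rw [zero_smul, add_zero]; exact hχs hz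
        have hl : ∀ p d : E, HasDerivAt (fun ε : ℝ => p + ε • d) d 0 := fun p d => by
          simpa using ((hasDerivAt_id (0 : ℝ)).smul_const d).const_add p
        have d1 := HasFDerivAt.comp_hasDerivAt (x := (0 : ℝ))
          (hl := ((hh.contDiffAt (hW.mem_nhds hzW)).differentiableAt (by simp)).hasFDerivAt)
          (hf := hl (u z) (χ z • e))
        have d2 := HasFDerivAt.comp_hasDerivAt (x := (0 : ℝ))
          (hl := ((hq.contDiffAt (hW.mem_nhds hzW)).differentiableAt (by simp)).hasFDerivAt)
          (hf := hl (u z) (χ z • e))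
        have d3 := ((d1.clm_apply (hl (dX u z) (fderiv ℝ χ z (1, 0) • e))).clm_apply
          (hl (dY u z) (fderiv ℝ χ z (0, 1) • e))).add d2
        refine d3.deriv.trans ?_
        simp only [zero_smul, add_zero, map_smul, _root_.smul_apply, smul_eq_mul,
          _root_.add_apply, Function.comp_apply, A, B, C]
        ring
      · have e1 : χ z = 0 := image_eq_zero_of_notMem_tsupport hz
        have e2 : fderiv ℝ χ z = 0 := by
          by_contra hne
          exact hz (support_fderiv_subset ℝ hne)
        simp [e1, e2]
    simp_rw [hfv] at hint
    have hx : ∀ v, Continuous fun z => fderiv ℝ χ z v := fun v =>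
      ((hχ.fderiv_right (m := ∞) (by simp)).clm_apply contDiff_const).continuous
    have i1 := integrable_mul_of_tsupport_subset hO hχ.continuous hχc hχs hA.continuousOn
    have i2 := integrable_mul_of_tsupport_subset hO (hx (1, 0)) (hχc.fderiv_apply (𝕜 := ℝ) _)
      ((tsupport_fderiv_apply_subset ℝ _).trans hχs) hB.continuousOn
    have i3 := integrable_mul_of_tsupport_subset hO (hx (0, 1)) (hχc.fderiv_apply (𝕜 := ℝ) _)
      ((tsupport_fderiv_apply_subset ℝ _).trans hχs) hC.continuousOn
    have i4 := integrable_mul_of_tsupport_subset hO hχ.continuous hχc hχs hBx.continuousOn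
    have i5 := integrable_mul_of_tsupport_subset hO hχ.continuous hχc hχs hCy.continuousOn
    rw [integral_add (by exact i1.add i2) i3, integral_add i1 i2,
      integral_fderiv_mul_eq_neg hO hχ hχc hχs hB, integral_fderiv_mul_eq_neg hO hχ hχc hχs hC]
      at hint
    simp_rw [smul_eq_mul, mul_sub]
    rw [integral_sub (by exact i1.sub i4) i5, integral_sub i1 i4]
    linarith
  have hev : EqOn (fun z => A z - fderiv ℝ B z (1, 0) - fderiv ℝ C z (0, 1)) 0 O :=
    Measure.eqOn_open_of_ae_eq ((ae_restrict_iff' hO.measurableSet).2 key) hO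
      ((hA.sub hBx).sub hCy).continuousOn continuousOn_const
  have h00 := hev h0
  have hu0 : u 0 = c := by simp [hu_def]
  have dh : HasFDerivAt (fun z => h (u z)) ((fderiv ℝ h (u 0)).comp (fderiv ℝ u 0)) 0 :=
    HasFDerivAt.comp 0
      ((hh.contDiffAt (hW.mem_nhds (by simpa [hu0] using hc))).differentiableAt
        (by simp)).hasFDerivAt (hu.differentiable (by simp) 0).hasFDerivAt
  have dB : fderiv ℝ B 0 (1, 0) = fderiv ℝ h c a e b + h c e m := by
    have d := (dh.clm_apply (hasFDerivAt_const e 0)).clm_apply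
      (cuy.differentiable (by simp) 0).hasFDerivAt
    have huyd : HasFDerivAt (dY u) ((ContinuousLinearMap.fst ℝ ℝ ℝ).smulRight m) 0 := by
      rw [huy]; exact (hasFDerivAt_fst.smul_const m).const_add b
    rw [d.fderiv, huyd.fderiv, (hdu 0).fderiv]
    simp [hu0, huy]
    ring
  have dC : fderiv ℝ C 0 (0, 1) = fderiv ℝ h c b a e + h c m e := by
    have d := (dh.clm_apply (cux.differentiable (by simp) 0).hasFDerivAt).clm_apply
      (hasFDerivAt_const e 0)
    have huxd : HasFDerivAt (dX u) ((ContinuousLinearMap.snd ℝ ℝ ℝ).smulRight m) 0 := by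
      rw [hux]; exact (hasFDerivAt_snd.smul_const m).const_add a
    rw [d.fderiv, huxd.fderiv, (hdu 0).fderiv]
    simp [hu0, hux]
    ring
  simp only [dB, dC, Pi.zero_apply, A, hu0, hux, huy] at h00
  simpa [eulerLagrange] using h00

/-- The Euler-Lagrange expression is a polynomial in the jet; its coefficients give the three
conditions. -/
theorem conditions_of_eulerLagrange {W : Set E} {h : E → E →L[ℝ] E →L[ℝ] ℝ}
    {q : E → ℝ} (H : ∀ c ∈ W, ∀ a b m e, eulerLagrange h q c a b m e = 0) {c : E} (hc : c ∈ W) :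
    fderiv ℝ q c = 0 ∧ (∀ a b, h c a b = - h c b a) ∧
      ∀ e a b, fderiv ℝ h c e a b = fderiv ℝ h c a e b + fderiv ℝ h c b a e := by
  have hq : ∀ e, fderiv ℝ q c e = 0 := fun e => by
    simpa [eulerLagrange] using H c hc 0 0 0 e
  refine ⟨ContinuousLinearMap.ext fun e => by simpa using hq e, fun a b => ?_, fun e a b => ?_⟩
  · have := H c hc 0 0 a b
    simp [eulerLagrange, hq] at this
    linarith
  · have := H c hc a b 0 e
    simp [eulerLagrange, hq] at this
    linarith

end EulerLagrange

/-! ### The Poincaré lemma for 2-forms on a star-shaped open set -/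

section Poincare

universe u

variable {E : Type u} [NormedAddCommGroup E] [NormedSpace ℝ E]

/-- Differentiation under the integral sign; the derivative of the integrand is bounded near
`{x} × [0, 1]` by compactness and the tube lemma. -/
theorem hasFDerivAt_integral_unitInterval {G : Type*} [NormedAddCommGroup G] [NormedSpace ℝ G]
    {F : E × ℝ → G} {O : Set (E × ℝ)} (hO : IsOpen O) (hF : ContDiffOn ℝ ∞ F O) {x : E}
    (hx : ∀ t ∈ Icc (0 : ℝ) 1, (x, t) ∈ O) :
    IntervalIntegrable (fun t => (fderiv ℝ F (x, t)).comp (ContinuousLinearMap.inl ℝ E ℝ))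
      volume 0 1 ∧
    HasFDerivAt (fun y => ∫ t in (0 : ℝ)..1, F (y, t))
      (∫ t in (0 : ℝ)..1, (fderiv ℝ F (x, t)).comp (ContinuousLinearMap.inl ℝ E ℝ)) x := by
  set F' : E × ℝ → E →L[ℝ] G := fun w => (fderiv ℝ F w).comp (ContinuousLinearMap.inl ℝ E ℝ)
  have hF' : ContinuousOn F' O :=
    ((hF.fderiv_of_isOpen (m := ∞) hO (by simp)).clm_comp contDiffOn_const).continuousOn
  obtain ⟨C, hC⟩ := (isCompact_singleton (x := x).prod (isCompact_Icc (a := (0 : ℝ))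
    (b := 1))).exists_bound_of_continuousOn (f := F') (hF'.mono (by
      rintro ⟨y, t⟩ ⟨rfl, ht⟩; exact hx t ht))
  have hN : IsOpen (O ∩ F' ⁻¹' Metric.ball 0 (C + 1)) :=
    hF'.isOpen_inter_preimage hO Metric.isOpen_ball
  obtain ⟨U, T, hU, -, hxU, hT, hUT⟩ := generalized_tube_lemma (isCompact_singleton (x := x))
    (isCompact_Icc (a := (0 : ℝ)) (b := 1)) hN (by
      rintro ⟨y, t⟩ ⟨rfl, ht⟩
      refine ⟨hx t ht, ?_⟩
      have := hC (y, t) ⟨rfl, ht⟩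
      simp only [mem_preimage, Metric.mem_ball, dist_zero_right]
      linarith)
  have hmem : ∀ y ∈ U, ∀ t ∈ Icc (0 : ℝ) 1, (y, t) ∈ O ∩ F' ⁻¹' Metric.ball 0 (C + 1) :=
    fun y hy t ht => hUT ⟨hy, hT ht⟩
  have hsub : uIoc (0 : ℝ) 1 ⊆ Icc 0 1 := by
    rw [uIoc_of_le zero_le_one]; exact Ioc_subset_Icc_self
  have hline : ∀ y : E, ContinuousOn (fun t : ℝ => (y, t)) (Icc (0 : ℝ) 1) := fun y => by fun_prop
  have hcF : ∀ y ∈ U, ContinuousOn (fun t : ℝ => F (y, t)) (Icc (0 : ℝ) 1) := fun y hy =>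
    hF.continuousOn.comp (hline y) fun t ht => (hmem y hy t ht).1
  have hcF' : ContinuousOn (fun t : ℝ => F' (x, t)) (Icc (0 : ℝ) 1) :=
    hF'.comp (hline x) fun t ht => hx t ht
  have hUx : U ∈ 𝓝 x := hU.mem_nhds (hxU rfl)
  refine ⟨?_, intervalIntegral.hasFDerivAt_integral_of_dominated_of_fderiv_le (𝕜 := ℝ)
    (F := fun y t => F (y, t)) (F' := fun y t => F' (y, t)) (bound := fun _ => C + 1)
    hUx ?_ ?_ ?_ ?_ ?_ ?_⟩
  · exact ContinuousOn.intervalIntegrable (by rwa [uIcc_of_le zero_le_one])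
  · filter_upwards [hUx] with y hy
    exact ((hcF y hy).aestronglyMeasurable measurableSet_Icc).mono_measure
      (Measure.restrict_mono hsub le_rfl)
  · exact ContinuousOn.intervalIntegrable (by
      rw [uIcc_of_le zero_le_one]; exact hcF x (hxU rfl))
  · exact (hcF'.aestronglyMeasurable measurableSet_Icc).mono_measure
      (Measure.restrict_mono hsub le_rfl)
  · refine ae_of_all _ fun t ht y hy => ?_
    simpa using (mem_ball_zero_iff.1 (hmem y hy t (hsub ht)).2).le
  · exact intervalIntegrable_const
  · refine ae_of_all _ fun t ht y hy => ?_
    have hd := ((hF.contDiffAt (hO.mem_nhds (hmem y hy t (hsub ht)).1)).differentiableAt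
      (by simp)).hasFDerivAt
    exact HasFDerivAt.comp (f := fun y : E => (y, t)) y hd (hasFDerivAt_prodMk_left y t)

/-- An integral over `[0, 1]` depends smoothly on a parameter: each derivative is again such an
integral. -/
theorem contDiffOn_integral_unitInterval {V : Set E} (hV : IsOpen V) {O : Set (E × ℝ)}
    (hO : IsOpen O) (hVO : ∀ x ∈ V, ∀ t ∈ Icc (0 : ℝ) 1, (x, t) ∈ O) {G : Type u}
    [NormedAddCommGroup G] [NormedSpace ℝ G] {F : E × ℝ → G} (hF : ContDiffOn ℝ ∞ F O) :
    ContDiffOn ℝ ∞ (fun y => ∫ t in (0 : ℝ)..1, F (y, t)) V := by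
  refine contDiffOn_infty.2 fun m => ?_
  induction m generalizing G with
  | zero =>
    exact contDiffOn_zero.2 fun x hx =>
      (hasFDerivAt_integral_unitInterval hO hF (hVO x hx)).2.continuousAt.continuousWithinAt
  | succ m ih =>
    rw [Nat.cast_add, Nat.cast_one]
    refine (contDiffOn_succ_iff_fderiv_of_isOpen hV).2 ⟨fun x hx =>
      (hasFDerivAt_integral_unitInterval hO hF
        (hVO x hx)).2.differentiableAt.differentiableWithinAt, fun h => absurd h (by simp), ?_⟩
    have hF' : ContDiffOn ℝ ∞
        (fun w => (fderiv ℝ F w).comp (ContinuousLinearMap.inl ℝ E ℝ)) O :=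
      (hF.fderiv_of_isOpen (m := ∞) hO (by simp)).clm_comp contDiffOn_const
    exact (ih hF').congr fun x hx => (hasFDerivAt_integral_unitInterval hO hF (hVO x hx)).2.fderiv

theorem hasFDerivAt_apply_apply {h : E → E →L[ℝ] E →L[ℝ] ℝ} {h' : E →L[ℝ] E →L[ℝ] E →L[ℝ] ℝ}
    {x : E} (hd : HasFDerivAt h h' x) (a b : E) :
    HasFDerivAt (fun y => h y a b) ((h'.flip a).flip b) x := by
  have := (hd.clm_apply (hasFDerivAt_const a x)).clm_apply (hasFDerivAt_const b x)
  refine this.congr_fderiv (ContinuousLinearMap.ext fun e => ?_)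
  simp

theorem fderiv_antisymm {V : Set E} (hV : IsOpen V) {h : E → E →L[ℝ] E →L[ℝ] ℝ}
    (hh : ContDiffOn ℝ ∞ h V) (hanti : ∀ x ∈ V, ∀ a b, h x a b = - h x b a) {x : E} (hx : x ∈ V)
    (e a b : E) : fderiv ℝ h x e a b = - fderiv ℝ h x e b a := by
  have hd := ((hh.contDiffAt (hV.mem_nhds hx)).differentiableAt (by simp)).hasFDerivAt
  have he : (fun y => h y a b) =ᶠ[𝓝 x] fun y => - h y b a := by
    filter_upwards [hV.mem_nhds hx] with y hy using hanti y hy a b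
  have h1 := congrArg (· e) (he.fderiv_eq.symm.trans (hasFDerivAt_apply_apply hd a b).fderiv)
  rw [(hasFDerivAt_apply_apply hd b a).fun_neg.fderiv] at h1
  simpa using h1.symm


/-- **Poincaré lemma** for 2-forms: the primitive is the integral of `t h(p + t (u - p))(u - p, ·)`
over `[0, 1]`. The last hypothesis is closedness, written with the help of antisymmetry. -/
theorem exists_primitive {V : Set E} (hV : IsOpen V) {p : E} (hstar : StarConvex ℝ p V)
    {h : E → E →L[ℝ] E →L[ℝ] ℝ} (hh : ContDiffOn ℝ ∞ h V)
    (hanti : ∀ x ∈ V, ∀ a b, h x a b = - h x b a)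
    (hclosed : ∀ x ∈ V, ∀ e a b, fderiv ℝ h x e a b = fderiv ℝ h x a e b + fderiv ℝ h x b a e) :
    ∃ θ : E → E →L[ℝ] ℝ, ContDiffOn ℝ ∞ θ V ∧
      ∀ x ∈ V, ∀ a b, fderiv ℝ θ x a b - fderiv ℝ θ x b a = h x a b := by
  set r : E × ℝ → E := fun w => p + w.2 • (w.1 - p)
  have hr : ContDiff ℝ ∞ r := by fun_prop
  set O : Set (E × ℝ) := r ⁻¹' V
  have hO : IsOpen O := hV.preimage hr.continuous
  have hVO : ∀ x ∈ V, ∀ t ∈ Icc (0 : ℝ) 1, (x, t) ∈ O := fun x hx t ht =>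
    hstar.add_smul_sub_mem hx ht.1 ht.2
  set F : E × ℝ → E →L[ℝ] ℝ := fun w => w.2 • h (r w) (w.1 - p)
  have hhr : ContDiffOn ℝ ∞ (fun w => h (r w)) O := hh.comp hr.contDiffOn fun _ hw => hw
  have hF : ContDiffOn ℝ ∞ F O :=
    contDiff_snd.contDiffOn.smul (hhr.clm_apply (contDiff_fst.sub contDiff_const).contDiffOn)
  refine ⟨fun y => ∫ t in (0 : ℝ)..1, F (y, t), contDiffOn_integral_unitInterval hV hO hVO hF,
    fun x hx a b => ?_⟩
  obtain ⟨hi, hd⟩ := hasFDerivAt_integral_unitInterval hO hF (hVO x hx)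
  have hdh : ∀ t ∈ Icc (0 : ℝ) 1, HasFDerivAt h (fderiv ℝ h (r (x, t))) (r (x, t)) := fun t ht =>
    ((hh.contDiffAt (hV.mem_nhds (hVO x hx t ht))).differentiableAt (by simp)).hasFDerivAt
  have hF' : ∀ t ∈ Icc (0 : ℝ) 1, ∀ a b, fderiv ℝ F (x, t) (a, 0) b
      = t ^ 2 * fderiv ℝ h (r (x, t)) a (x - p) b + t * h (r (x, t)) a b := by
    intro t ht a b
    have h1 : HasFDerivAt (fun y => r (y, t)) (t • ContinuousLinearMap.id ℝ E) x :=
      (((hasFDerivAt_id x).sub_const p).const_smul t).const_add p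
    have h2 := ((HasFDerivAt.comp x (hdh t ht) h1).clm_apply
      ((hasFDerivAt_id x).sub_const p)).const_smul t
    have h3 : HasFDerivAt (fun y => F (y, t))
        ((fderiv ℝ F (x, t)).comp (ContinuousLinearMap.inl ℝ E ℝ)) x :=
      HasFDerivAt.comp (f := fun y : E => (y, t)) x
        (((hF.contDiffAt (hO.mem_nhds (hVO x hx t ht))).differentiableAt
        (by simp)).hasFDerivAt) (hasFDerivAt_prodMk_left x t)
    have h4 := congrArg (fun l : E →L[ℝ] E →L[ℝ] ℝ => l a b) (h3.unique h2)
    simp at h4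
    rw [h4, map_sub, _root_.sub_apply]
    ring
  have hap : ∀ {G : Type u} [NormedAddCommGroup G] [NormedSpace ℝ G] {φ : ℝ → E →L[ℝ] G},
      IntervalIntegrable φ volume 0 1 → ∀ v, IntervalIntegrable (fun t => φ t v) volume 0 1 :=
    fun hφ v => ⟨hφ.1.apply_continuousLinearMap v, hφ.2.apply_continuousLinearMap v⟩
  have happ : ∀ a b, fderiv ℝ (fun y => ∫ t in (0 : ℝ)..1, F (y, t)) x a b
      = ∫ t in (0 : ℝ)..1, fderiv ℝ F (x, t) (a, 0) b := by
    intro a b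
    rw [hd.fderiv, ContinuousLinearMap.intervalIntegral_apply hi,
      ContinuousLinearMap.intervalIntegral_apply (hap hi a)]
    simp
  have hint : ∀ a b, IntervalIntegrable (fun t => fderiv ℝ F (x, t) (a, 0) b) volume 0 1 :=
    fun a b => ⟨(hap hi a).1.apply_continuousLinearMap b, (hap hi a).2.apply_continuousLinearMap b⟩
  rw [happ, happ, ← intervalIntegral.integral_sub (hint a b) (hint b a)]
  -- The integrand is the derivative of `t ^ 2 * h (p + t (x - p)) a b`.
  have hderiv : ∀ t ∈ uIcc (0 : ℝ) 1, HasDerivAt (fun t => t ^ 2 * h (r (x, t)) a b)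
      (fderiv ℝ F (x, t) (a, 0) b - fderiv ℝ F (x, t) (b, 0) a) t := by
    intro t ht
    rw [uIcc_of_le zero_le_one] at ht
    have h1 : HasDerivAt (fun t => r (x, t)) (x - p) t := by
      have := ((hasDerivAt_id t).smul_const (x - p)).const_add p
      rwa [one_smul] at this
    have h2 : HasDerivAt (fun t => h (r (x, t)) a b)
        (fderiv ℝ h (r (x, t)) (x - p) a b) t := by
      exact HasFDerivAt.comp_hasDerivAt t (hasFDerivAt_apply_apply (hdh t ht) a b) h1
    refine ((hasDerivAt_pow 2 t).mul h2).congr_deriv ?_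
    have hm := hVO x hx t ht
    rw [hF' t ht, hF' t ht, hanti _ hm b a]
    have := hclosed _ hm (x - p) a b
    rw [fderiv_antisymm hV hh hanti hm b a (x - p)] at this
    rw [this]
    push_cast
    ring
  rw [intervalIntegral.integral_eq_sub_of_hasDerivAt hderiv ((hint a b).sub (hint b a))]
  simp [r]

end Poincare

/-! ### The system in terms of forms -/

section Forms

variable {n : ℕ} {V : Set (Fin n → ℝ)} {G : Fin n → Fin n → Fin n → (Fin n → ℝ) → ℝ}
  {Q : Fin n → (Fin n → ℝ) → ℝ} {R : Fin n → (Fin n → ℝ) → ℝ}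

/-- The 1-form `R_α dU^α`. -/
def covectorForm (R : Fin n → (Fin n → ℝ) → ℝ) (u : Fin n → ℝ) : (Fin n → ℝ) →L[ℝ] ℝ :=
  ∑ α, R α u • ContinuousLinearMap.proj α

/-- The bilinear form `(a, b) ↦ -∇_γ R_β a^β b^γ`; the index of differentiation goes with the
second argument, which takes the value `U_y`. -/
def negCovDerivBilin (G : Fin n → Fin n → Fin n → (Fin n → ℝ) → ℝ)
    (R : Fin n → (Fin n → ℝ) → ℝ) (u : Fin n → ℝ) : (Fin n → ℝ) →L[ℝ] (Fin n → ℝ) →L[ℝ] ℝ :=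
  ∑ β, ∑ γ, (-covDeriv G R γ β u) •
    (ContinuousLinearMap.proj (R := ℝ) (φ := fun _ : Fin n => ℝ) β).smulRight
      (ContinuousLinearMap.proj (R := ℝ) (φ := fun _ : Fin n => ℝ) γ)

theorem covectorForm_apply (u a : Fin n → ℝ) : covectorForm R u a = ∑ α, R α u * a α := by
  simp [covectorForm]

theorem negCovDerivBilin_apply (u a b : Fin n → ℝ) :
    negCovDerivBilin G R u a b = ∑ β, ∑ γ, -covDeriv G R γ β u * (a β * b γ) := by
  simp [negCovDerivBilin]

theorem negCovDerivBilin_single (u : Fin n → ℝ) (α β : Fin n) :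
    negCovDerivBilin G R u (Pi.single α 1) (Pi.single β 1) = -covDeriv G R β α u := by
  simp [negCovDerivBilin_apply, Pi.single_apply]

theorem contDiffOn_covectorForm (hR : ∀ α, ContDiffOn ℝ ∞ (R α) V) :
    ContDiffOn ℝ ∞ (covectorForm R) V :=
  ContDiffOn.sum fun α _ => (hR α).smul contDiffOn_const

theorem contDiffOn_covDeriv (hV : IsOpen V) (hG : ∀ α β γ, ContDiffOn ℝ ∞ (G α β γ) V)
    (hR : ∀ α, ContDiffOn ℝ ∞ (R α) V) (α β : Fin n) : ContDiffOn ℝ ∞ (covDeriv G R α β) V :=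
  (((hR β).fderiv_of_isOpen (m := ∞) hV (by simp)).clm_apply contDiffOn_const).sub
    (ContDiffOn.sum fun δ _ => (hG δ β α).mul (hR δ))

theorem contDiffOn_negCovDerivBilin (hV : IsOpen V) (hG : ∀ α β γ, ContDiffOn ℝ ∞ (G α β γ) V)
    (hR : ∀ α, ContDiffOn ℝ ∞ (R α) V) : ContDiffOn ℝ ∞ (negCovDerivBilin G R) V :=
  ContDiffOn.sum fun β _ => ContDiffOn.sum fun γ _ =>
    (contDiffOn_covDeriv hV hG hR γ β).neg.smul contDiffOn_const

theorem fderiv_covectorForm_apply {u : Fin n → ℝ} (hR : ∀ α, DifferentiableAt ℝ (R α) u)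
    (a b : Fin n → ℝ) : fderiv ℝ (covectorForm R) u a b = ∑ α, fderiv ℝ (R α) u a * b α := by
  have h : HasFDerivAt (covectorForm R) (∑ α, (fderiv ℝ (R α) u).smulRight
      (ContinuousLinearMap.proj (R := ℝ) (φ := fun _ : Fin n => ℝ) α)) u :=
    HasFDerivAt.fun_sum fun α _ => (hR α).hasFDerivAt.smul_const
      (ContinuousLinearMap.proj (R := ℝ) (φ := fun _ : Fin n => ℝ) α)
  rw [h.fderiv]
  simp

/-- Up to the total derivative `D_y (R_α U^α_x)`, the first two terms on the right, `R_α Δ^α` is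
the Lagrangian `-∇_γ R_β U^β_x U^γ_y + R_α Q^α`. -/
theorem sum_mul_systemLHS {j : Jet n} (hR : ∀ α, DifferentiableAt ℝ (R α) (j.2 (0, 0))) :
    ∑ α, zerothOrder R α j * systemLHS G Q α j
      = fderiv ℝ (covectorForm R) (j.2 (0, 0)) (j.2 (0, 1)) (j.2 (1, 0))
        + covectorForm R (j.2 (0, 0)) (j.2 (1, 1))
        + negCovDerivBilin G R (j.2 (0, 0)) (j.2 (1, 0)) (j.2 (0, 1))
        + ∑ α, R α (j.2 (0, 0)) * Q α (j.2 (0, 0)) := by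
  rw [fderiv_covectorForm_apply hR, covectorForm_apply, negCovDerivBilin_apply]
  generalize hb' : j.2 (0, 1) = b
  have hb : ∀ β, fderiv ℝ (R β) (j.2 (0, 0)) b
      = ∑ γ, b γ * fderiv ℝ (R β) (j.2 (0, 0)) (Pi.single γ 1) := fun β => by
    conv_lhs => rw [pi_eq_sum_univ' b, map_sum]
    simp [map_smul]
  have hG : ∑ α, R α (j.2 (0, 0)) * ∑ β, ∑ γ, G α β γ (j.2 (0, 0)) * j.2 (1, 0) β * b γ
      = ∑ β, ∑ γ, ∑ δ, G δ β γ (j.2 (0, 0)) * R δ (j.2 (0, 0)) * (j.2 (1, 0) β * b γ) := by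
    simp_rw [Finset.mul_sum]
    rw [Finset.sum_comm]
    refine Finset.sum_congr rfl fun β _ => ?_
    rw [Finset.sum_comm]
    exact Finset.sum_congr rfl fun γ _ => Finset.sum_congr rfl fun δ _ => by ring
  have hh : ∑ β, ∑ γ, -covDeriv G R γ β (j.2 (0, 0)) * (j.2 (1, 0) β * b γ)
      = ∑ α, R α (j.2 (0, 0)) * ∑ β, ∑ γ, G α β γ (j.2 (0, 0)) * j.2 (1, 0) β * b γ
        - ∑ α, fderiv ℝ (R α) (j.2 (0, 0)) b * j.2 (1, 0) α := by
    rw [hG, ← Finset.sum_sub_distrib]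
    refine Finset.sum_congr rfl fun β _ => ?_
    rw [hb β, Finset.sum_mul, ← Finset.sum_sub_distrib]
    refine Finset.sum_congr rfl fun γ _ => ?_
    rw [covDeriv, ← Finset.sum_mul]
    ring
  rw [hh]
  simp only [zerothOrder, systemLHS, mul_add, Finset.sum_add_distrib, hb']
  ring

/-- The form `∇_α R_β dU^α ∧ dU^β` is the antisymmetrisation of `-∇_γ R_β a^β b^γ`. -/
theorem covDerivForm_apply (u : Fin n → ℝ) (v : Fin 2 → Fin n → ℝ) :
    covDerivForm G R u v
      = negCovDerivBilin G R u (v 0) (v 1) - negCovDerivBilin G R u (v 1) (v 0) := by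
  have h1 : covDerivForm G R u v
      = ∑ α, ∑ β, covDeriv G R α β u * (v 0 α * v 1 β - v 0 β * v 1 α) := by
    simp [covDerivForm, ContinuousAlternatingMap.sum_apply, dWedge_apply]
  rw [h1, negCovDerivBilin_apply, negCovDerivBilin_apply, ← Finset.sum_sub_distrib]
  refine Finset.sum_comm.trans (Finset.sum_congr rfl fun β _ => ?_)
  rw [← Finset.sum_sub_distrib]
  exact Finset.sum_congr rfl fun α _ => by ring

theorem isKillingCovector_iff :
    IsKillingCovector V G R ↔ ∀ u ∈ V, ∀ a b : Fin n → ℝ,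
      negCovDerivBilin G R u a b = - negCovDerivBilin G R u b a := by
  refine ⟨fun h u hu a b => ?_, fun h u hu α β => ?_⟩
  · rw [negCovDerivBilin_apply, negCovDerivBilin_apply, Finset.sum_comm, ← Finset.sum_neg_distrib]
    refine Finset.sum_congr rfl fun γ _ => ?_
    rw [← Finset.sum_neg_distrib]
    refine Finset.sum_congr rfl fun β _ => ?_
    have := h u hu β γ
    linear_combination (-2 * a β * b γ) * this
  · have := h u hu (Pi.single α 1) (Pi.single β 1)
    rw [negCovDerivBilin_single, negCovDerivBilin_single] at this
    linarith

theorem contDiffOn_covDerivForm (hV : IsOpen V) (hG : ∀ α β γ, ContDiffOn ℝ ∞ (G α β γ) V)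
    (hR : ∀ α, ContDiffOn ℝ ∞ (R α) V) : ContDiffOn ℝ ∞ (covDerivForm G R) V :=
  ContDiffOn.sum fun α _ => ContDiffOn.sum fun β _ =>
    (contDiffOn_covDeriv hV hG hR α β).smul contDiffOn_const

/-- For an antisymmetric `h = -∇_γ R_β`, closedness of `∇_α R_β dU^α ∧ dU^β` is the vanishing of
the cyclic sum of `dh`, written as it appears in the Euler-Lagrange equations. -/
theorem extDeriv_covDerivForm_eq_zero_iff (hV : IsOpen V)
    (hG : ∀ α β γ, ContDiffOn ℝ ∞ (G α β γ) V) (hR : ∀ α, ContDiffOn ℝ ∞ (R α) V)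
    (hanti : ∀ u ∈ V, ∀ a b : Fin n → ℝ,
      negCovDerivBilin G R u a b = - negCovDerivBilin G R u b a) {u : Fin n → ℝ} (hu : u ∈ V) :
    extDeriv (covDerivForm G R) u = 0 ↔ ∀ e a b : Fin n → ℝ,
      fderiv ℝ (negCovDerivBilin G R) u e a b
        = fderiv ℝ (negCovDerivBilin G R) u a e b + fderiv ℝ (negCovDerivBilin G R) u b a e := by
  have hc := contDiffOn_negCovDerivBilin hV hG hR
  have hd := ((hc.contDiffAt (hV.mem_nhds hu)).differentiableAt (by simp)).hasFDerivAt
  have hω : DifferentiableAt ℝ (covDerivForm G R) u :=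
    ((contDiffOn_covDerivForm hV hG hR).contDiffAt (hV.mem_nhds hu)).differentiableAt (by simp)
  have ha := fderiv_antisymm hV hc hanti hu
  have key : ∀ v : Fin 3 → Fin n → ℝ, extDeriv (covDerivForm G R) u v
      = 2 * (fderiv ℝ (negCovDerivBilin G R) u (v 0) (v 1) (v 2)
        - fderiv ℝ (negCovDerivBilin G R) u (v 1) (v 0) (v 2)
        - fderiv ℝ (negCovDerivBilin G R) u (v 2) (v 1) (v 0)) := by
    intro v
    have hf : ∀ (w : Fin 2 → Fin n → ℝ) (e : Fin n → ℝ),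
        fderiv ℝ (fun y => covDerivForm G R y w) u e
          = 2 * fderiv ℝ (negCovDerivBilin G R) u e (w 0) (w 1) := by
      intro w e
      simp only [covDerivForm_apply]
      rw [((hasFDerivAt_apply_apply hd (w 0) (w 1)).fun_sub
        (hasFDerivAt_apply_apply hd (w 1) (w 0))).fderiv]
      simp only [_root_.sub_apply, ContinuousLinearMap.flip_apply]
      rw [ha e (w 1) (w 0)]
      ring
    refine (extDeriv_apply hω v).trans ((Fin.sum_univ_three _).trans ?_)
    simp only [hf]
    have e1 := ha (v 2) (v 0) (v 1)
    simp [Fin.removeNth, Fin.succAbove, e1]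
    ring
  refine ⟨fun h e a b => ?_, fun h => ?_⟩
  · have := key ![e, a, b]
    rw [h] at this
    simp at this
    linarith
  · ext v
    rw [key v, h (v 0) (v 1) (v 2)]
    simp

end Forms

/-! ### Necessity of the conditions -/

section Necessity

variable {n : ℕ}

/-- The jet of `u + ε φ` at `z`, as a function of `(z, ε)`. -/
def variationJet (u φ : ℝ × ℝ → Fin n → ℝ) (w : (ℝ × ℝ) × ℝ) : Jet n :=
  (w.1, fun J => prolong u w.1 J + w.2 • prolong φ w.1 J)

variable {W : Set (Fin n → ℝ)} {u φ : ℝ × ℝ → Fin n → ℝ}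

theorem contDiff_variationJet (hu : ContDiff ℝ ∞ u) (hφ : ContDiff ℝ ∞ φ) (J : ℕ × ℕ) :
    ContDiff ℝ ∞ fun w => (variationJet u φ w).2 J :=
  ((contDiff_prolong hu J).comp contDiff_fst).add
    (contDiff_snd.smul ((contDiff_prolong hφ J).comp contDiff_fst))

theorem fderiv_variationJet (hu : ContDiff ℝ ∞ u) (hφ : ContDiff ℝ ∞ φ) (J : ℕ × ℕ)
    (w : (ℝ × ℝ) × ℝ) (v : ℝ × ℝ) :
    fderiv ℝ (fun w => (variationJet u φ w).2 J) w (v, 0)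
      = fderiv ℝ (fun z => prolong u z J) w.1 v
        + w.2 • fderiv ℝ (fun z => prolong φ z J) w.1 v := by
  have h1 := HasFDerivAt.comp w (((contDiff_prolong hu J).differentiable (by simp)
    w.1).hasFDerivAt) (hasFDerivAt_fst (p := w))
  have h2 := HasFDerivAt.comp w (((contDiff_prolong hφ J).differentiable (by simp)
    w.1).hasFDerivAt) (hasFDerivAt_fst (p := w))
  have h3 : HasFDerivAt (fun w => (variationJet u φ w).2 J) _ w :=
    h1.add ((hasFDerivAt_snd (p := w)).smul h2)
  rw [h3.fderiv]
  simp

theorem fderiv_variationJet_x (hu : ContDiff ℝ ∞ u) (hφ : ContDiff ℝ ∞ φ) (J : ℕ × ℕ)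
    (w : (ℝ × ℝ) × ℝ) : fderiv ℝ (fun w => (variationJet u φ w).2 J) w ((1, 0), 0)
      = (variationJet u φ w).2 (J.1 + 1, J.2) := by
  rw [fderiv_variationJet hu hφ]
  exact congrArg₂ (fun a b => a + w.2 • b) (congrFun (dX_prolong u J) w.1)
    (congrFun (dX_prolong φ J) w.1)

theorem fderiv_variationJet_y (hu : ContDiff ℝ ∞ u) (hφ : ContDiff ℝ ∞ φ) (J : ℕ × ℕ)
    (w : (ℝ × ℝ) × ℝ) : fderiv ℝ (fun w => (variationJet u φ w).2 J) w ((0, 1), 0)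
      = (variationJet u φ w).2 (J.1, J.2 + 1) := by
  rw [fderiv_variationJet hu hφ]
  exact congrArg₂ (fun a b => a + w.2 • b) (congrFun (dY_prolong hu J) w.1)
    (congrFun (dY_prolong hφ J) w.1)

theorem variationJet_eq {K : Set (ℝ × ℝ)} (hK : IsClosed K) (hφ : ∀ z ∉ K, φ z = 0)
    {z : ℝ × ℝ} (hz : z ∉ K) (ε : ℝ) : variationJet u φ (z, ε) = variationJet u φ (z, 0) := by
  simp [variationJet, prolong_eq_zero hK hφ _ z hz]

/-- Along the jets of a variation, total derivatives are partial derivatives. -/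
theorem fderiv_comp_variationJet (hW : IsOpen W) {k : ℕ} {p : FinJet n k → ℝ}
    (hp : ContDiffOn ℝ ∞ p (jetDomain k W)) (hu : ContDiff ℝ ∞ u) (hφ : ContDiff ℝ ∞ φ)
    {w : (ℝ × ℝ) × ℝ} (hw : (variationJet u φ w).2 (0, 0) ∈ W) (v : ℝ × ℝ) :
    fderiv ℝ (fun w => p (truncate k (variationJet u φ w))) w (v, 0)
      = fderiv ℝ p (truncate k (variationJet u φ w))
        (v, fun J => fderiv ℝ (fun w => (variationJet u φ w).2 J.1) w (v, 0)) := by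
  have h1 : HasFDerivAt (fun w => truncate k (variationJet u φ w))
      ((ContinuousLinearMap.fst ℝ (ℝ × ℝ) ℝ).prod (ContinuousLinearMap.pi fun J =>
        fderiv ℝ (fun w => (variationJet u φ w).2 J.1) w)) w :=
    hasFDerivAt_fst.prodMk (hasFDerivAt_pi.2 fun J =>
      ((contDiff_variationJet hu hφ J.1).differentiable (by simp) w).hasFDerivAt)
  have h2 := HasFDerivAt.comp w (hasFDerivAt_jet hW hp
    (w := truncate k (variationJet u φ w)) hw) h1
  have h3 := congrArg (· (v, 0)) h2.fderiv
  exact h3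

variable {G : Fin n → Fin n → Fin n → (Fin n → ℝ) → ℝ}
  {Q : Fin n → (Fin n → ℝ) → ℝ} {R : Fin n → (Fin n → ℝ) → ℝ}

/-- If `R_α(U)` is the characteristic of a conservation law, the Lagrangian left over by
`sum_mul_systemLHS` is a null Lagrangian. -/
theorem eulerLagrange_of_isCharacteristic (hW : IsOpen W)
    (hG : ∀ α β γ, ContDiffOn ℝ ∞ (G α β γ) W) (hQ : ∀ α, ContDiffOn ℝ ∞ (Q α) W)
    (hR : ∀ α, ContDiffOn ℝ ∞ (R α) W) (h : IsCharacteristic W G Q (zerothOrder R))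
    {c : Fin n → ℝ} (hc : c ∈ W) (a b m e : Fin n → ℝ) :
    eulerLagrange (negCovDerivBilin G R) (fun u => ∑ α, R α u * Q α u) c a b m e = 0 := by
  obtain ⟨-, L₁, L₂, ⟨k₁, p₁, hp₁, hL₁⟩, ⟨k₂, p₂, hp₂, hL₂⟩, hdiv⟩ := h
  refine eulerLagrange_eq_zero hW (contDiffOn_negCovDerivBilin hW hG hR)
    (ContDiffOn.sum fun α _ => (hR α).mul (hQ α)) ?_ hc a b m e
  intro u e χ hu hχ hχc hχs
  set φ : ℝ × ℝ → Fin n → ℝ := fun z => χ z • e with hφ_def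
  have hφ : ContDiff ℝ ∞ φ := hχ.smul contDiff_const
  have hφK : ∀ z ∉ tsupport χ, φ z = 0 := fun z hz => by
    simp [hφ_def, image_eq_zero_of_notMem_tsupport hz]
  have hK := isClosed_tsupport χ
  set v : ℕ × ℕ → (ℝ × ℝ) × ℝ → Fin n → ℝ := fun J w => (variationJet u φ w).2 J
  have hv : ∀ J, ContDiff ℝ ∞ (v J) := contDiff_variationJet hu hφ
  set O : Set ((ℝ × ℝ) × ℝ) := v (0, 0) ⁻¹' W
  have hO : IsOpen O := hW.preimage (hv _).continuous
  have htr : ∀ k, ContDiff ℝ ∞ fun w => truncate k (variationJet u φ w) := fun k =>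
    contDiff_fst.prodMk (contDiff_pi.2 fun J => hv J.1)
  have hρ : ContDiffOn ℝ ∞ (fun w => covectorForm R (v (0, 0) w) (v (1, 0) w)) O :=
    ((contDiffOn_covectorForm hR).comp (hv _).contDiffOn fun _ hw => hw).clm_apply
      (hv _).contDiffOn
  have hf₂ : ContDiffOn ℝ ∞ (fun w => p₂ (truncate k₂ (variationJet u φ w))) O :=
    hp₂.comp (htr k₂).contDiffOn fun _ hw => hw
  -- By `sum_mul_systemLHS`, subtracting `R_α U^α_x` from `L₂` leaves a divergence
  -- equal to the Lagrangian.
  refine integral_firstVariation_eq_zero hO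
    (f₁ := fun w => p₁ (truncate k₁ (variationJet u φ w)))
    (f₂ := fun w => p₂ (truncate k₂ (variationJet u φ w))
      - covectorForm R (v (0, 0) w) (v (1, 0) w))
    (hp₁.comp (htr k₁).contDiffOn fun _ hw => hw) (hf₂.sub hρ) ?_ (K := tsupport χ)
    hχc ?_ ?_ ?_ ?_
  · intro w hw
    have hwW : (variationJet u φ w).2 (0, 0) ∈ W := hw
    have e1 : fderiv ℝ (fun w => p₁ (truncate k₁ (variationJet u φ w))) w ((1, 0), 0)
        = totalDx L₁ (variationJet u φ w) := by
      rw [fderiv_comp_variationJet hW hp₁ hu hφ hwW, totalDx_eq hW hp₁ hL₁ _ hwW]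
      simp only [fderiv_variationJet_x hu hφ]
    have e2 : fderiv ℝ (fun w => p₂ (truncate k₂ (variationJet u φ w))) w ((0, 1), 0)
        = totalDy L₂ (variationJet u φ w) := by
      rw [fderiv_comp_variationJet hW hp₂ hu hφ hwW, totalDy_eq hW hp₂ hL₂ _ hwW]
      simp only [fderiv_variationJet_y hu hφ]
    have e3 : fderiv ℝ (fun w => covectorForm R (v (0, 0) w) (v (1, 0) w)) w ((0, 1), 0)
        = fderiv ℝ (covectorForm R) (v (0, 0) w) (v (0, 1) w) (v (1, 0) w)
          + covectorForm R (v (0, 0) w) (v (1, 1) w) := by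
      have d1 := HasFDerivAt.comp w ((((contDiffOn_covectorForm hR).contDiffAt
        (hW.mem_nhds hwW)).differentiableAt (by simp)).hasFDerivAt)
        ((hv (0, 0)).differentiable (by simp) w).hasFDerivAt
      have d2 := congrArg (· ((0, 1), 0)) (d1.clm_apply
        ((hv (1, 0)).differentiable (by simp) w).hasFDerivAt).fderiv
      refine d2.trans ?_
      have y1 := fderiv_variationJet_y hu hφ (0, 0) w
      have y2 := fderiv_variationJet_y hu hφ (1, 0) w
      change fderiv ℝ (v (0, 0)) w ((0, 1), 0) = v (0, 1) w at y1
      change fderiv ℝ (v (1, 0)) w ((0, 1), 0) = v (1, 1) w at y2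
      simp [y1, y2]
      ring
    have e4 := sum_mul_systemLHS (G := G) (Q := Q) (j := variationJet u φ w) fun α =>
      ((hR α).contDiffAt (hW.mem_nhds hwW)).differentiableAt (by simp)
    have hl : lagrangian (negCovDerivBilin G R) (fun u => ∑ α, R α u * Q α u) u φ w
        = negCovDerivBilin G R (v (0, 0) w) (v (1, 0) w) (v (0, 1) w)
          + ∑ α, R α (v (0, 0) w) * Q α (v (0, 0) w) := rfl
    have hs : fderiv ℝ (fun w => p₂ (truncate k₂ (variationJet u φ w))
        - covectorForm R (v (0, 0) w) (v (1, 0) w)) w ((0, 1), 0)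
        = totalDy L₂ (variationJet u φ w)
          - (fderiv ℝ (covectorForm R) (v (0, 0) w) (v (0, 1) w) (v (1, 0) w)
            + covectorForm R (v (0, 0) w) (v (1, 1) w)) := by
      rw [fderiv_fun_sub ((hf₂.contDiffAt (hO.mem_nhds hw)).differentiableAt (by simp))
        ((hρ.contDiffAt (hO.mem_nhds hw)).differentiableAt (by simp)), _root_.sub_apply, e2, e3]
    have hd := hdiv _ hwW
    rw [e1, hs, hl]
    rw [e4] at hd
    linarith
  · intro z hz
    have : v (0, 0) (z, 0) = u z := by simp [v, variationJet, prolong]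
    change v (0, 0) (z, 0) ∈ W
    rw [this]
    exact hχs hz
  · intro z hz ε
    simp only [variationJet_eq hK hφK hz ε]
  · intro z hz ε
    simp only [v, variationJet_eq hK hφK hz ε]
  · intro z hz ε
    have hx : dX φ z = 0 := prolong_eq_zero hK hφK (1, 0) z hz
    have hy : dY φ z = 0 := prolong_eq_zero hK hφK (0, 1) z hz
    simp [lagrangian, hφK z hz, hx, hy]

theorem satisfiesConditions_of_isLocalCharacteristic {V : Set (Fin n → ℝ)} (hV : IsOpen V)
    (hVc : IsPreconnected V) (hG : ∀ α β γ, ContDiffOn ℝ ∞ (G α β γ) V)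
    (hQ : ∀ α, ContDiffOn ℝ ∞ (Q α) V) (hR : ∀ α, ContDiffOn ℝ ∞ (R α) V)
    (h : IsLocalCharacteristic V G Q (zerothOrder R)) : SatisfiesConditions V G Q R := by
  have H : ∀ c ∈ V, ∀ a b m e, eulerLagrange (negCovDerivBilin G R)
      (fun u => ∑ α, R α u * Q α u) c a b m e = 0 := by
    intro c hc a b m e
    obtain ⟨W, hW, hcW, hWV, hchar⟩ := h c hc
    exact eulerLagrange_of_isCharacteristic hW (fun α β γ => (hG α β γ).mono hWV)
      (fun α => (hQ α).mono hWV) (fun α => (hR α).mono hWV) hchar hcW a b m e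
  have hanti : ∀ u ∈ V, ∀ a b : Fin n → ℝ,
      negCovDerivBilin G R u a b = - negCovDerivBilin G R u b a := fun u hu =>
    (conditions_of_eulerLagrange H hu).2.1
  refine ⟨isKillingCovector_iff.2 hanti, ?_, fun u hu =>
    (extDeriv_covDerivForm_eq_zero_iff hV hG hR hanti hu).2
      (conditions_of_eulerLagrange H hu).2.2⟩
  exact hV.exists_is_const_of_fderiv_eq_zero hVc
    ((ContDiffOn.sum fun α _ => (hR α).mul (hQ α)).differentiableOn (n := ∞) (by simp))
    fun u hu => (conditions_of_eulerLagrange H hu).1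

end Necessity

/-! ### Sufficiency of the conditions -/

section Sufficiency

variable {n : ℕ} {W : Set (Fin n → ℝ)}

/-- The differential function `κ_α(U) U^α_J + c x`. -/
def linearCurrent (κ : (Fin n → ℝ) → (Fin n → ℝ) →L[ℝ] ℝ) (c : ℝ) (J : ℕ × ℕ) (j : Jet n) : ℝ :=
  κ (j.2 (0, 0)) (j.2 J) + c * j.1.1

variable {κ : (Fin n → ℝ) → (Fin n → ℝ) →L[ℝ] ℝ} {c : ℝ} {J : ℕ × ℕ}

/-- The function on the jet space of order one that represents `linearCurrent`. -/
def linearCurrentRep (κ : (Fin n → ℝ) → (Fin n → ℝ) →L[ℝ] ℝ) (c : ℝ)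
    (J : {J // J ∈ multiIndices 1}) (j : FinJet n 1) : ℝ :=
  κ (j.2 ⟨(0, 0), zero_mem_multiIndices 1⟩) (j.2 J) + c * j.1.1

theorem contDiffOn_linearCurrentRep (hκ : ContDiffOn ℝ ∞ κ W) (c : ℝ)
    (J : {J // J ∈ multiIndices 1}) :
    ContDiffOn ℝ ∞ (linearCurrentRep κ c J) (jetDomain 1 W) := by
  have hc : ∀ I : {J // J ∈ multiIndices 1}, ContDiff ℝ ∞ fun j : FinJet n 1 => j.2 I :=
    fun I => by fun_prop
  have h1 : ContDiff ℝ ∞ fun j : FinJet n 1 => c * j.1.1 := by fun_prop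
  exact ((hκ.comp (hc _).contDiffOn fun _ hj => hj).clm_apply (hc J).contDiffOn).add
    h1.contDiffOn

theorem isDifferentialFunction_linearCurrent (hκ : ContDiffOn ℝ ∞ κ W) (c : ℝ)
    (hJ : J ∈ multiIndices 1) : IsDifferentialFunction W (linearCurrent κ c J) :=
  ⟨1, linearCurrentRep κ c ⟨J, hJ⟩, contDiffOn_linearCurrentRep hκ c ⟨J, hJ⟩, fun _ _ => rfl⟩

theorem fderiv_linearCurrentRep (hW : IsOpen W) (hκ : ContDiffOn ℝ ∞ κ W) (c : ℝ)
    (J : {J // J ∈ multiIndices 1}) {j : FinJet n 1} (hj : j ∈ jetDomain 1 W) (v : FinJet n 1) :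
    fderiv ℝ (linearCurrentRep κ c J) j v
      = fderiv ℝ κ (j.2 ⟨(0, 0), zero_mem_multiIndices 1⟩)
          (v.2 ⟨(0, 0), zero_mem_multiIndices 1⟩) (j.2 J)
        + κ (j.2 ⟨(0, 0), zero_mem_multiIndices 1⟩) (v.2 J) + c * v.1.1 := by
  have hc : ∀ I : {J // J ∈ multiIndices 1}, HasFDerivAt (fun j : FinJet n 1 => j.2 I)
      ((ContinuousLinearMap.proj I).comp (ContinuousLinearMap.snd ℝ _ _)) j := fun I =>
    ((ContinuousLinearMap.proj (R := ℝ) (φ := fun _ : {J // J ∈ multiIndices 1} => Fin n → ℝ)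
      I).comp (ContinuousLinearMap.snd ℝ (ℝ × ℝ) _)).hasFDerivAt
  have hx : HasFDerivAt (fun j : FinJet n 1 => c * j.1.1)
      (c • (ContinuousLinearMap.fst ℝ ℝ ℝ).comp (ContinuousLinearMap.fst ℝ _ _)) j :=
    (hasFDerivAt_fst.comp j hasFDerivAt_fst).const_mul c
  have h1 := HasFDerivAt.comp j (((hκ.contDiffAt (hW.mem_nhds hj)).differentiableAt
    (by simp)).hasFDerivAt) (hc ⟨(0, 0), zero_mem_multiIndices 1⟩)
  have h2 := congrArg (· v) ((h1.clm_apply (hc J)).add hx).fderiv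
  refine Eq.trans h2 ?_
  simp
  ring

theorem totalDx_linearCurrent (hW : IsOpen W) (hκ : ContDiffOn ℝ ∞ κ W) (c : ℝ)
    (hJ : J ∈ multiIndices 1) {j : Jet n} (hj : j.2 (0, 0) ∈ W) :
    totalDx (linearCurrent κ c J) j = fderiv ℝ κ (j.2 (0, 0)) (j.2 (1, 0)) (j.2 J)
      + κ (j.2 (0, 0)) (j.2 (J.1 + 1, J.2)) + c := by
  rw [totalDx_eq (P := linearCurrent κ c J) hW (contDiffOn_linearCurrentRep hκ c ⟨J, hJ⟩)
      (fun _ _ => rfl) j hj,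
    fderiv_linearCurrentRep hW hκ c ⟨J, hJ⟩ (by exact hj)]
  simp [truncate]

theorem totalDy_linearCurrent (hW : IsOpen W) (hκ : ContDiffOn ℝ ∞ κ W) (c : ℝ)
    (hJ : J ∈ multiIndices 1) {j : Jet n} (hj : j.2 (0, 0) ∈ W) :
    totalDy (linearCurrent κ c J) j = fderiv ℝ κ (j.2 (0, 0)) (j.2 (0, 1)) (j.2 J)
      + κ (j.2 (0, 0)) (j.2 (J.1, J.2 + 1)) := by
  rw [totalDy_eq (P := linearCurrent κ c J) hW (contDiffOn_linearCurrentRep hκ c ⟨J, hJ⟩)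
      (fun _ _ => rfl) j hj,
    fderiv_linearCurrentRep hW hκ c ⟨J, hJ⟩ (by exact hj)]
  simp [truncate]

variable {G : Fin n → Fin n → Fin n → (Fin n → ℝ) → ℝ}
  {Q : Fin n → (Fin n → ℝ) → ℝ} {R : Fin n → (Fin n → ℝ) → ℝ}

/-- On a star-shaped domain `-∇_γ R_β a^β b^γ` has a primitive `θ`, and
`L₁ = θ_α U^α_y + c x`, `L₂ = (R_α - θ_α) U^α_x` is a conservation law. -/
theorem isCharacteristic_of_satisfiesConditions (hW : IsOpen W) {p : Fin n → ℝ}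
    (hstar : StarConvex ℝ p W) (hG : ∀ α β γ, ContDiffOn ℝ ∞ (G α β γ) W)
    (hR : ∀ α, ContDiffOn ℝ ∞ (R α) W) (h : SatisfiesConditions W G Q R) :
    IsCharacteristic W G Q (zerothOrder R) := by
  obtain ⟨hkill, ⟨c, hc⟩, hclosed⟩ := h
  have hanti := isKillingCovector_iff.1 hkill
  obtain ⟨θ, hθ, hdθ⟩ := exists_primitive hW hstar (contDiffOn_negCovDerivBilin hW hG hR) hanti
    fun u hu => (extDeriv_covDerivForm_eq_zero_iff hW hG hR hanti hu).1 (hclosed u hu)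
  have hρ := contDiffOn_covectorForm hR
  have h10 : ((1, 0) : ℕ × ℕ) ∈ multiIndices 1 := by simp [multiIndices]
  have h01 : ((0, 1) : ℕ × ℕ) ∈ multiIndices 1 := by simp [multiIndices]
  refine ⟨fun α => ⟨0, fun j => R α (j.2 ⟨(0, 0), zero_mem_multiIndices 0⟩),
    (hR α).comp (t := W) (ContDiff.contDiffOn (by fun_prop)) fun _ hj => hj, fun _ _ => rfl⟩,
    linearCurrent θ c (0, 1), linearCurrent (fun u => covectorForm R u - θ u) 0 (1, 0),
    isDifferentialFunction_linearCurrent hθ c h01,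
    isDifferentialFunction_linearCurrent (hρ.sub hθ) 0 h10, fun j hj => ?_⟩
  have dθ := (hθ.contDiffAt (hW.mem_nhds hj)).differentiableAt (by simp)
  have dρ := (hρ.contDiffAt (hW.mem_nhds hj)).differentiableAt (by simp)
  rw [totalDx_linearCurrent hW hθ c h01 hj, totalDy_linearCurrent hW (hρ.sub hθ) 0 h10 hj,
    sum_mul_systemLHS fun α => ((hR α).contDiffAt (hW.mem_nhds hj)).differentiableAt (by simp),
    hc _ hj, ← hdθ _ hj, fderiv_fun_sub dρ dθ]
  simp only [_root_.sub_apply]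
  ring

end Sufficiency

end ChiralType

end

theorem theorem2 {n : ℕ} (V : Set (Fin n → ℝ)) (hV : IsOpen V) (hVc : IsPreconnected V)
    (G : Fin n → Fin n → Fin n → (Fin n → ℝ) → ℝ)
    (hG : ∀ α β γ, ContDiffOn ℝ ∞ (G α β γ) V)
    (Q : Fin n → (Fin n → ℝ) → ℝ) (hQ : ∀ α, ContDiffOn ℝ ∞ (Q α) V)
    (R : Fin n → (Fin n → ℝ) → ℝ) (hR : ∀ α, ContDiffOn ℝ ∞ (R α) V) :
    (ChiralType.IsLocalCharacteristic V G Q (ChiralType.zerothOrder R) ↔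
      ChiralType.SatisfiesConditions V G Q R) ∧
    ((∃ p ∈ V, StarConvex ℝ p V) →
      (ChiralType.IsCharacteristic V G Q (ChiralType.zerothOrder R) ↔
        ChiralType.SatisfiesConditions V G Q R)) := by
  have hnec := ChiralType.satisfiesConditions_of_isLocalCharacteristic hV hVc hG hQ hR
  refine ⟨⟨hnec, fun h u hu => ?_⟩, fun ⟨p, _, hstar⟩ => ⟨fun h => hnec fun u hu =>
    ⟨V, hV, hu, subset_rfl, h⟩, ChiralType.isCharacteristic_of_satisfiesConditions hV hstar hG hR⟩⟩
  obtain ⟨r, hr, hball⟩ := Metric.isOpen_iff.1 hV u hu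
  refine ⟨Metric.ball u r, Metric.isOpen_ball, Metric.mem_ball_self hr, hball,
    ChiralType.isCharacteristic_of_satisfiesConditions Metric.isOpen_ball
      ((convex_ball u r).starConvex (Metric.mem_ball_self hr))
      (fun α β γ => (hG α β γ).mono hball) (fun α => (hR α).mono hball) ?_⟩
  obtain ⟨h1, ⟨c, h2⟩, h3⟩ := h
  exact ⟨fun x hx => h1 x (hball hx), ⟨c, fun x hx => h2 x (hball hx)⟩,
    fun x hx => h3 x (hball hx)⟩
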